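/- Conventions. For a real random variable $\xi$ and $\alpha>0$, let $\|\xi\|_{\psi_\alpha}=\inf\{t>0:\mathbb E\exp(|\xi/t|^\alpha)\le 2\}$ (with $\inf\emptyset=\infty$), and for a random vector $X$ in $\mathbb R^m$ let $\|X\|_{\psi_\alpha}=\sup_{\|x\|_2=1}\|\langle X,x\rangle\|_{\psi_\alpha}$. For a set $T\subset\mathbb R^n$ let $\mathrm{rad}(T)=\sup_{t\in T}\|t\|_2$ and $$\gamma_\alpha(T)=\inf_{(\mathcal A_k)}\ \sup_{t\in T}\ \sum_{k\ge 0}2^{k/\alpha}\,\mathrm{diam}(A_k(t)),$$ where the infimum is over all sequences $(\mathcal A_k)_{k\ge0}$ of successively refining partitions of $T$ with $|\mathcal A_0|=1$ and $|\mathcal A_k|\le 2^{2^k}$ for $k\ge1$, $A_k(t)$ is the part of $\mathcal A_k$ that contains $t$, and $\mathrm{diam}$ is the Euclidean diameter. Theorem (Column-wise model). There are an absolute constant $C$ and, for every $\alpha\in(0,2]$, a constant $C(\alpha)$ depending only on $\alpha$, such that the following holds. Let $A$ be a random $m\times n$ real matrix whose columns $A_1,\dots,A_n$ are independent mean-zero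 random vectors in $\mathbb R^m$ with $\|A_i\|_2=1$ almost surely and $\|A_i\|_{\psi_\alpha}\le K$ for every $i$, and let $T\subset\mathbb R^n$ be a bounded set. Then $$\mathbb E\sup_{x\in T}\bigl|\|Ax\|_2-\|x\|_2\bigr|\le C(\alpha)\,K\,\bigl(\gamma_\alpha(T)+\mathrm{rad}(T)\bigr).$$ Moreover, for every $u\ge 0$, with probability at least $1-Ce^{-u^\alpha}$, $$\sup_{x\in T}\bigl|\|Ax\|_2-\|x\|_2\bigr|\le C(\alpha)\,K\,\bigl(\gamma_\alpha(T)+u\,\mathrm{rad}(T)\bigr).$$ -/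

import Mathlib

open MeasureTheory ProbabilityTheory
open scoped NNReal ENNReal

noncomputable section

/-- The `ψ_α` (quasi-)norm of a real random variable `ξ` under `P`:
`inf {t > 0 : E exp (|ξ / t| ^ α) ≤ 2}`, with value `∞` when no such `t` exists. -/
def psiNorm {Ω : Type*} [MeasurableSpace Ω] (P : Measure Ω) (α : ℝ) (ξ : Ω → ℝ) : ℝ≥0∞ :=
  ⨅ (t : ℝ) (_ : 0 < t)
    (_ : ∫⁻ ω, ENNReal.ofReal (Real.exp (|ξ ω / t| ^ α)) ∂P ≤ 2), ENNReal.ofReal t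

/-- The `ψ_α` (quasi-)norm of a random vector in `ℝ^m`: the supremum of the `ψ_α` norms of its
one-dimensional marginals over the Euclidean unit sphere. -/
def psiNormVec {Ω : Type*} [MeasurableSpace Ω] (P : Measure Ω) (α : ℝ) {m : ℕ}
    (X : Ω → EuclideanSpace ℝ (Fin m)) : ℝ≥0∞ :=
  ⨆ x ∈ Metric.sphere (0 : EuclideanSpace ℝ (Fin m)) 1, psiNorm P α (fun ω => inner ℝ (X ω) x)

/-- An admissible sequence of partitions of `X`. A partition is given as the equivalence relation
whose classes are its parts, so that `S n` finer than `S k` means `S n ≤ S k`. There is one part at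
level `0` and there are at most `2 ^ 2 ^ k` parts at each level `k ≥ 1`. -/
structure IsAdmissible {X : Type*} (S : ℕ → Setoid X) : Prop where
  refines : ∀ k, S (k + 1) ≤ S k
  card_zero : (S 0).classes.encard = 1
  card_le : ∀ k, 1 ≤ k → (S k).classes.encard ≤ 2 ^ 2 ^ k

/-- The part of the partition `S` that contains `t`. -/
def partOf {X : Type*} (S : Setoid X) (t : X) : Set X := {s | S s t}

/-- Talagrand's functional `γ_α(X, d)`: the infimum over admissible sequences of
`sup_t ∑_{k ≥ 0} 2 ^ (k / α) * diam (A_k(t))`, where `A_k(t)` is the part of the `k`-th partition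
that contains `t`. -/
def talagrandGamma (α : ℝ) (X : Type*) [PseudoEMetricSpace X] : ℝ≥0∞ :=
  ⨅ (S : ℕ → Setoid X) (_ : IsAdmissible S),
    ⨆ t : X, ∑' k : ℕ, (2 : ℝ≥0∞) ^ ((k : ℝ) / α) * Metric.ediam (partOf (S k) t)

/-- `rad(T) = sup_{t ∈ T} ‖t‖₂`. -/
def rad {n : ℕ} (T : Set (EuclideanSpace ℝ (Fin n))) : ℝ≥0∞ := ⨆ t ∈ T, ‖t‖ₑ

/-- The `j`-th column of a matrix as a vector of Euclidean space. -/
def euclCol {m n : ℕ} (A : Matrix (Fin m) (Fin n) ℝ) (j : Fin n) : EuclideanSpace ℝ (Fin m) :=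
  WithLp.toLp 2 (fun i => A i j)

/-- The matrix-vector product `A x` as a vector of Euclidean space. -/
def euclMulVec {m n : ℕ} (A : Matrix (Fin m) (Fin n) ℝ) (x : EuclideanSpace ℝ (Fin n)) :
    EuclideanSpace ℝ (Fin m) :=
  WithLp.toLp 2 (A.mulVec x.ofLp)

/-- The maximal distortion `sup_{x ∈ T} | ‖A x‖₂ - ‖x‖₂ |` of `A` on `T`, as an extended
nonnegative number. -/
def distortion {m n : ℕ} (A : Matrix (Fin m) (Fin n) ℝ) (T : Set (EuclideanSpace ℝ (Fin n))) :
    ℝ≥0∞ :=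
  ⨆ x ∈ T, ENNReal.ofReal |‖euclMulVec A x‖ - ‖x‖|

end

set_option linter.unusedSectionVars false

/-! ### Even moments of sums of independent centred variables -/

section

/-! The deviation `‖Ax‖ - ‖x‖` is a process in `x` whose increments have `L^p` norm at most `C(α) K
p^(1/α) ‖x - y‖` for `p = 2 * 2 ^ r`; this is exactly what generic chaining with `γ_α` consumes
(`integral_deviation_sub_pow_le`, `exists_chaining_bound`).

Because the columns are unit vectors, `⟪Au, Av⟫ - ⟪u, v⟫` has no diagonal part. Decoupling writes it
as an average of inner products `⟪U, V⟫` built from disjoint sets of columns. With `U` frozen, a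
Khintchine-type inequality bounds the `2k`-th moment by powers of `q = 8 σ k^β`, where `β = 2/α` and
`σ` is of order `K^2`, times the moment of `‖U‖`. The latter comes from a bootstrap: `‖Au‖^2` is
`‖u‖^2` plus a chaos, so norm moments of order `2k` control those of order `4k`.

The chaos alone costs `q (1 + q)`, which would give `K^2`. Passing to norms restores `q`: for `q ≥
1` the triangle inequality is enough, and for `q < 1` the chaos bound is already linear in `q`. For
unit `x, y` the difference of squared norms is the centred chaos `⟪A(x - y), A(x + y)⟫`; small
values of `‖Ax‖`, where division by `‖Ax‖ + ‖Ay‖` fails, are paid for by `|‖Ax‖^2 - 1|`.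

In the chaining, high powers of all normalized links are summed into one variable `Φ` of mean at
most `2 exp(-2^k₀)`. The level `k₀ = 0` gives the expectation; `2^k₀` comparable to `u^α` and
Markov's inequality give the tail. -/

theorem pow_add_mul_le_pow_of_even (k : ℕ) (hk : 1 ≤ k) (s y : ℝ) :
    s ^ (2 * k) + (2 * k) * s ^ (2 * k - 1) * (y - s) ≤ y ^ (2 * k) := by
  rcases eq_or_ne s 0 with rfl | hs
  · rw [zero_pow (by omega), zero_pow (by omega)]
    simpa using (even_two_mul k).pow_nonneg y
  · obtain ⟨t, rfl⟩ : ∃ t, y = s * (1 + t) := ⟨y / s - 1, by field_simp; ring⟩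
    have h1 : 1 + (2 * k : ℝ) * t ≤ (1 + t) ^ (2 * k) := by
      -- Bernoulli's inequality needs `-2 ≤ t`; below that the left side is nonpositive.
      rcases le_or_gt (-2) t with h | h
      · simpa using one_add_mul_le_pow h (2 * k)
      · have hk' : (1 : ℝ) ≤ k := by exact_mod_cast hk
        have : 1 + (2 * k : ℝ) * t ≤ 0 := by nlinarith
        exact this.trans ((even_two_mul k).pow_nonneg _)
    have h2 : s ^ (2 * k) = s ^ (2 * k - 1) * s := by
      rw [← pow_succ]; congr 1; omega
    rw [mul_pow]
    calc s ^ (2 * k) + (2 * k) * s ^ (2 * k - 1) * (s * (1 + t) - s)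
        = s ^ (2 * k) * (1 + (2 * k : ℝ) * t) := by rw [h2]; ring
      _ ≤ _ := mul_le_mul_of_nonneg_left h1 ((even_two_mul k).pow_nonneg s)

/-- A pointwise substitute for symmetrization: convexity at the midpoint of `s + 2x` and `s`, then
the tangent at `s` evaluated at `s - 2x`. The linear term vanishes in mean for centred `x`
independent of `s`, and the average has only even powers of `x`. -/
theorem add_pow_le_symmetrized (k : ℕ) (hk : 1 ≤ k) (s x : ℝ) :
    (s + x) ^ (2 * k) ≤ ((s + 2 * x) ^ (2 * k) + (s - 2 * x) ^ (2 * k)) / 2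
      + (2 * k) * s ^ (2 * k - 1) * x := by
  have h1 := pow_add_mul_le_pow_of_even k hk s (s - 2 * x)
  have h2 := (even_two_mul k).convexOn_pow.2 (Set.mem_univ (s + 2 * x)) (Set.mem_univ s)
    (by norm_num : (0 : ℝ) ≤ 1 / 2) (by norm_num : (0 : ℝ) ≤ 1 / 2) (by norm_num)
  simp only [smul_eq_mul] at h2
  rw [show (1 / 2 : ℝ) * (s + 2 * x) + 1 / 2 * s = s + x by ring] at h2
  nlinarith

theorem sum_range_two_mul_add_one {M : Type*} [AddCommMonoid M] (f : ℕ → M) (k : ℕ) :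
    ∑ i ∈ Finset.range (2 * k + 1), f i
      = ∑ l ∈ Finset.range (k + 1), f (2 * l) + ∑ l ∈ Finset.range k, f (2 * l + 1) := by
  induction k with
  | zero => simp
  | succ k ih =>
    rw [show 2 * (k + 1) + 1 = 2 * k + 1 + 1 + 1 by ring, Finset.sum_range_succ,
      Finset.sum_range_succ, ih, Finset.sum_range_succ _ (k + 1),
      Finset.sum_range_succ (fun l => f (2 * l + 1)) k]
    rw [show 2 * (k + 1) = 2 * k + 1 + 1 by ring]
    abel

theorem add_pow_add_sub_pow (k : ℕ) (s y : ℝ) :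
    ((s + y) ^ (2 * k) + (s - y) ^ (2 * k)) / 2
      = ∑ l ∈ Finset.range (k + 1),
        ((2 * k).choose (2 * l) : ℝ) * (s ^ (2 * (k - l)) * y ^ (2 * l)) := by
  have h1 : (s + y) ^ (2 * k) = ∑ i ∈ Finset.range (2 * k + 1),
      y ^ i * s ^ (2 * k - i) * ((2 * k).choose i : ℝ) := by rw [add_comm s y, add_pow]
  have h2 : (s - y) ^ (2 * k) = ∑ i ∈ Finset.range (2 * k + 1),
      (-y) ^ i * s ^ (2 * k - i) * ((2 * k).choose i : ℝ) := by
    rw [sub_eq_neg_add s y, add_pow]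
  rw [h1, h2, sum_range_two_mul_add_one, sum_range_two_mul_add_one]
  have e1 : ∀ l, (-y) ^ (2 * l) = y ^ (2 * l) := fun l => (even_two_mul l).neg_pow y
  have e2 : ∀ l, (-y) ^ (2 * l + 1) = - y ^ (2 * l + 1) := fun l =>
    (odd_two_mul_add_one l).neg_pow y
  simp only [e1, e2, neg_mul, Finset.sum_neg_distrib]
  rw [show ∀ a b : ℝ, (a + b + (a + -b)) / 2 = a by intros; ring]
  refine Finset.sum_congr rfl fun l _ => ?_
  rw [Nat.mul_sub]; ring

variable {Ω : Type*} [MeasurableSpace Ω] {P : Measure Ω}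

theorem MeasureTheory.MemLp.top_mul {f g : Ω → ℝ} (hf : MemLp f ∞ P) (hg : MemLp g ∞ P) :
    MemLp (fun ω => f ω * g ω) ∞ P := hg.mul hf

theorem MeasureTheory.MemLp.top_pow {f : Ω → ℝ} [IsFiniteMeasure P] (hf : MemLp f ∞ P) (k : ℕ) :
    MemLp (fun ω => f ω ^ k) ∞ P := by
  induction k with
  | zero => simpa using memLp_const 1
  | succ k ih => simpa [pow_succ] using ih.top_mul hf

/-- `(2k)! / k!`, the growth of the even moments of a Gaussian variable up to scaling. -/
noncomputable def evenMomentCoeff (k : ℕ) : ℝ := ((2 * k).factorial : ℝ) / (k.factorial : ℝ)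

theorem evenMomentCoeff_nonneg (k : ℕ) : 0 ≤ evenMomentCoeff k := by
  unfold evenMomentCoeff; positivity

/-- Converts the even part of a binomial expansion of order `2k` into a full one of order `k`, so
that these coefficients reproduce themselves under independent sums. -/
theorem evenMomentCoeff_choose (k l : ℕ) (h : l ≤ k) :
    ((2 * k).choose (2 * l) : ℝ) * (evenMomentCoeff (k - l) * evenMomentCoeff l)
      = evenMomentCoeff k * (k.choose l : ℝ) := by
  unfold evenMomentCoeff
  rw [Nat.cast_choose ℝ h, Nat.cast_choose ℝ (by omega : 2 * l ≤ 2 * k), ← Nat.mul_sub]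
  have := fun n : ℕ => (Nat.cast_ne_zero (R := ℝ)).2 n.factorial_ne_zero
  have h1 := this (2 * k)
  have h2 := this (2 * l)
  have h3 := this (2 * (k - l))
  have h4 := this k
  have h5 := this l
  have h6 := this (k - l)
  field_simp

/-- The variance proxies add; the factor `4` is the square of the `2` in `add_pow_le_symmetrized`.
-/
theorem integral_add_pow_le [IsProbabilityMeasure P] {S ξ : Ω → ℝ} (hS : MemLp S ∞ P)
    (hξ : MemLp ξ ∞ P) (hind : IndepFun S ξ P) (h0 : ∫ ω, ξ ω ∂P = 0) {M : ℕ} {D d : ℝ}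
    (hD : 0 ≤ D)
    (hSm : ∀ k ≤ M, ∫ ω, S ω ^ (2 * k) ∂P ≤ evenMomentCoeff k * D ^ k)
    (hξm : ∀ k ≤ M, ∫ ω, ξ ω ^ (2 * k) ∂P ≤ evenMomentCoeff k * d ^ k) {k : ℕ} (hk : k ≤ M) :
    ∫ ω, (S ω + ξ ω) ^ (2 * k) ∂P ≤ evenMomentCoeff k * (D + 4 * d) ^ k := by
  rcases Nat.eq_zero_or_pos k with rfl | hk1
  · simp [evenMomentCoeff]
  have hint : ∀ {f : Ω → ℝ}, MemLp f ∞ P → Integrable f P := fun hf => hf.integrable le_top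
  have hprod : ∀ a b : ℕ, ∫ ω, S ω ^ a * ξ ω ^ b ∂P = (∫ ω, S ω ^ a ∂P) * ∫ ω, ξ ω ^ b ∂P := by
    intro a b
    exact (hind.comp (measurable_id.pow_const a) (measurable_id.pow_const b)
      ).integral_fun_mul_eq_mul_integral (hS.top_pow a).1 (hξ.top_pow b).1
  have hlast : ∫ ω, (2 * k) * S ω ^ (2 * k - 1) * ξ ω ∂P = 0 := by
    have := hprod (2 * k - 1) 1
    simp only [pow_one, h0, mul_zero] at this
    simp only [mul_assoc, integral_const_mul, this, mul_zero]
  have hM1 : ∀ l, MemLp (fun ω => ((2 * k).choose (2 * l) : ℝ) *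
      (S ω ^ (2 * (k - l)) * (2 * ξ ω) ^ (2 * l))) ∞ P := fun l =>
    (((hS.top_pow _).top_mul ((hξ.const_mul 2).top_pow _)).const_mul _)
  calc ∫ ω, (S ω + ξ ω) ^ (2 * k) ∂P
      ≤ ∫ ω, ((∑ l ∈ Finset.range (k + 1), ((2 * k).choose (2 * l) : ℝ) *
          (S ω ^ (2 * (k - l)) * (2 * ξ ω) ^ (2 * l))) + (2 * k) * S ω ^ (2 * k - 1) * ξ ω) ∂P := by
        refine integral_mono (hint ((hS.add hξ).top_pow _)) ?_ fun ω => ?_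
        · refine Integrable.add (integrable_finsetSum _ fun l _ => hint (hM1 l)) (hint ?_)
          exact ((hS.top_pow _).const_mul _).top_mul hξ
        · have := add_pow_le_symmetrized k hk1 (S ω) (ξ ω)
          rwa [add_pow_add_sub_pow] at this
    _ = ∑ l ∈ Finset.range (k + 1), ((2 * k).choose (2 * l) : ℝ) *
          ((∫ ω, S ω ^ (2 * (k - l)) ∂P) * (4 ^ l * ∫ ω, ξ ω ^ (2 * l) ∂P)) := by
        rw [integral_add (integrable_finsetSum _ fun l _ => hint (hM1 l))
          (hint (((hS.top_pow _).const_mul _).top_mul hξ)), hlast, add_zero,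
          integral_finsetSum _ fun l _ => hint (hM1 l)]
        refine Finset.sum_congr rfl fun l _ => ?_
        rw [integral_const_mul]
        congr 1
        have : ∀ ω, S ω ^ (2 * (k - l)) * (2 * ξ ω) ^ (2 * l)
            = 4 ^ l * (S ω ^ (2 * (k - l)) * ξ ω ^ (2 * l)) := fun ω => by
          rw [mul_pow, pow_mul 2 2 l]; norm_num; ring
        simp only [this]
        rw [integral_const_mul, hprod]; ring
    _ ≤ ∑ l ∈ Finset.range (k + 1), ((2 * k).choose (2 * l) : ℝ) *
          ((evenMomentCoeff (k - l) * D ^ (k - l)) * (4 ^ l * (evenMomentCoeff l * d ^ l))) := by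
        refine Finset.sum_le_sum fun l hl => ?_
        have hl' : l ≤ k := by simpa [Nat.lt_succ_iff] using hl
        refine mul_le_mul_of_nonneg_left ?_ (Nat.cast_nonneg _)
        refine mul_le_mul (hSm _ (by omega)) (mul_le_mul_of_nonneg_left (hξm _ (by omega))
          (by positivity)) ?_ (mul_nonneg (evenMomentCoeff_nonneg _) (pow_nonneg hD _))
        exact mul_nonneg (by positivity)
          (integral_nonneg fun ω => (even_two_mul l).pow_nonneg _)
    _ = evenMomentCoeff k * (D + 4 * d) ^ k := by
        rw [add_comm D, add_pow, Finset.mul_sum]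
        refine Finset.sum_congr rfl fun l hl => ?_
        have hl' : l ≤ k := by simpa [Nat.lt_succ_iff] using hl
        have := evenMomentCoeff_choose k l hl'
        rw [mul_pow]
        linear_combination (D ^ (k - l) * 4 ^ l * d ^ l) * this

/-- Khintchine-type inequality: moments of a sum of independent centred variables whose even
moments grow in a Gaussian way up to order `2 M`. -/
theorem integral_sum_pow_le [IsProbabilityMeasure P] {ι : Type*} (s : Finset ι) {ξ : ι → Ω → ℝ}
    (hm : ∀ i, Measurable (ξ i)) (hind : iIndepFun ξ P) (hb : ∀ i, MemLp (ξ i) ∞ P)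
    (h0 : ∀ i, ∫ ω, ξ i ω ∂P = 0) {d : ι → ℝ} (hd : ∀ i, 0 ≤ d i) {M : ℕ}
    (hmom : ∀ i, ∀ k ≤ M, ∫ ω, ξ i ω ^ (2 * k) ∂P ≤ evenMomentCoeff k * d i ^ k) :
    ∀ k ≤ M, ∫ ω, (∑ i ∈ s, ξ i ω) ^ (2 * k) ∂P
      ≤ evenMomentCoeff k * (4 * ∑ i ∈ s, d i) ^ k := by
  classical
  induction s using Finset.induction_on with
  | empty =>
    intro k _
    rcases Nat.eq_zero_or_pos k with rfl | hk
    · simp [evenMomentCoeff]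
    · simp [hk.ne']
  | insert a s ha ih =>
    intro k hk
    have hi : IndepFun (fun ω => ∑ i ∈ s, ξ i ω) (ξ a) P := by
      have := hind.indepFun_finsetSum_of_notMem hm ha
      convert this using 1
      ext ω; simp
    have := integral_add_pow_le (memLp_finsetSum s fun i _ => hb i) (hb a) hi (h0 a)
      (by have := Finset.sum_nonneg fun i (_ : i ∈ s) => hd i; positivity) ih (hmom a) hk
    simp only [Finset.sum_insert ha]
    simpa [mul_add, add_comm] using this

end

/-! ### Decoupling and linear combinations of random vectors -/

section

theorem pow_self_le_evenMomentCoeff (l : ℕ) : (l : ℝ) ^ l ≤ evenMomentCoeff l := by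
  unfold evenMomentCoeff
  rw [le_div_iff₀ (by positivity)]
  have h : l.factorial * (l + 1) ^ l ≤ (l + l).factorial := Nat.factorial_mul_pow_le_factorial
  have h2 : l ^ l ≤ (l + 1) ^ l := Nat.pow_le_pow_left (by omega) _
  have : l ^ l * l.factorial ≤ (2 * l).factorial := by
    rw [two_mul]; nlinarith [l.factorial_pos]
  exact_mod_cast this

theorem evenMomentCoeff_le (k : ℕ) : evenMomentCoeff k ≤ (2 * k : ℝ) ^ k := by
  unfold evenMomentCoeff
  rw [div_le_iff₀ (by positivity)]
  have h := Nat.factorial_mul_descFactorial (show k ≤ 2 * k by omega)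
  have h2 := Nat.descFactorial_le_pow (2 * k) k
  rw [show 2 * k - k = k by omega] at h
  have : (2 * k).factorial ≤ (2 * k) ^ k * k.factorial := by
    rw [← h, mul_comm]; exact Nat.mul_le_mul_right _ h2
  exact_mod_cast this

/-- The separating sets form the interval from `{i}` to the complement of `{j}`, a quarter of all
subsets. -/
theorem four_mul_card_separating {ι : Type*} [Fintype ι] [DecidableEq ι] {i j : ι} (h : i ≠ j) :
    4 * (Finset.univ.filter fun I : Finset ι => i ∈ I ∧ j ∉ I).card = 2 ^ Fintype.card ι := by
  have h1 : (Finset.univ.filter fun I : Finset ι => i ∈ I ∧ j ∉ I)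
      = Finset.Icc {i} (Finset.univ.erase j) := by
    ext I
    simp only [Finset.mem_filter, Finset.mem_univ, true_and, Finset.mem_Icc,
      Finset.singleton_subset_iff]
    refine and_congr_right fun _ => ⟨fun hj x hx => ?_, fun hs hj => ?_⟩
    · exact Finset.mem_erase.2 ⟨fun e => hj (e ▸ hx), Finset.mem_univ _⟩
    · exact (Finset.mem_erase.1 (hs hj)).1 rfl
  have h2 : 2 ≤ Fintype.card ι := Fintype.one_lt_card_iff.2 ⟨i, j, h⟩
  rw [h1, Finset.card_Icc_finset (by simpa using h), Finset.card_erase_of_mem (Finset.mem_univ _),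
    Finset.card_singleton, Finset.card_univ, show 4 = 2 ^ 2 by norm_num, ← pow_add]
  congr 1; omega

/-- Decoupling: an off-diagonal double sum is an average of double sums over complementary
index sets. -/
theorem sum_offDiag_eq_average {ι : Type*} [Fintype ι] [DecidableEq ι] (B : ι → ι → ℝ) :
    ∑ i, ∑ j, (if i = j then 0 else B i j)
      = ∑ I : Finset ι, ((2 : ℝ) ^ Fintype.card ι)⁻¹ * (4 * ∑ i ∈ I, ∑ j ∈ Iᶜ, B i j) := by
  have h1 : ∀ I : Finset ι, ∑ i ∈ I, ∑ j ∈ Iᶜ, B i j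
      = ∑ i, ∑ j, (if i ∈ I ∧ j ∉ I then B i j else 0) := by
    intro I
    rw [← Finset.sum_filter_add_sum_filter_not Finset.univ (· ∈ I)]
    have : ∑ i with i ∉ I, ∑ j, (if i ∈ I ∧ j ∉ I then B i j else 0) = 0 :=
      Finset.sum_eq_zero fun i hi => by simp_all
    rw [this, add_zero]
    refine Finset.sum_congr (by ext; simp) fun i hi => ?_
    rw [← Finset.sum_filter]
    refine Finset.sum_congr ?_ fun _ _ => rfl
    have hi' : i ∈ I := by simpa using hi
    ext j; simp [hi']
  simp only [h1]
  simp only [Finset.mul_sum]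
  rw [Finset.sum_comm (s := (Finset.univ : Finset (Finset ι)))]
  refine Finset.sum_congr rfl fun i _ => ?_
  rw [Finset.sum_comm (s := (Finset.univ : Finset (Finset ι)))]
  refine Finset.sum_congr rfl fun j _ => ?_
  split_ifs with h
  · subst h; simp
  · have h2 := four_mul_card_separating h
    have h3 : (4 : ℝ) * (Finset.univ.filter fun I : Finset ι => i ∈ I ∧ j ∉ I).card
      = 2 ^ Fintype.card ι := by exact_mod_cast h2
    rw [← Finset.mul_sum, ← Finset.mul_sum, ← Finset.sum_filter, Finset.sum_const, nsmul_eq_mul]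
    rw [← h3]
    have h4 : (4 : ℝ) * (Finset.univ.filter fun I : Finset ι => i ∈ I ∧ j ∉ I).card ≠ 0 := by
      rw [h3]; positivity
    rw [← mul_assoc (4 : ℝ), inv_mul_cancel_left₀ h4]

section LinComb

variable {Ω E ι : Type*} [NormedAddCommGroup E] [InnerProductSpace ℝ E] [Fintype ι]

/-- The linear combination `∑ x_j Y_j` of random vectors. -/
def linComb (Y : ι → Ω → E) (x : EuclideanSpace ℝ ι) (ω : Ω) : E := ∑ j, x j • Y j ω

theorem linComb_add (Y : ι → Ω → E) (x y : EuclideanSpace ℝ ι) (ω : Ω) :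
    linComb Y (x + y) ω = linComb Y x ω + linComb Y y ω := by
  simp [linComb, add_smul, Finset.sum_add_distrib]

theorem linComb_sub (Y : ι → Ω → E) (x y : EuclideanSpace ℝ ι) (ω : Ω) :
    linComb Y (x - y) ω = linComb Y x ω - linComb Y y ω := by
  simp [linComb, sub_smul, Finset.sum_sub_distrib]

theorem linComb_smul (Y : ι → Ω → E) (a : ℝ) (x : EuclideanSpace ℝ ι) (ω : Ω) :
    linComb Y (a • x) ω = a • linComb Y x ω := by
  simp [linComb, Finset.smul_sum, mul_smul]

open Classical in
/-- The restriction of a vector to the coordinates in `I`. -/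
noncomputable def coordRestrict (I : Finset ι) (x : EuclideanSpace ℝ ι) : EuclideanSpace ℝ ι :=
  WithLp.toLp 2 fun j => if j ∈ I then x j else 0

theorem norm_coordRestrict_le (I : Finset ι) (x : EuclideanSpace ℝ ι) :
    ‖coordRestrict I x‖ ≤ ‖x‖ := by
  rw [← sq_le_sq₀ (norm_nonneg _) (norm_nonneg _), EuclideanSpace.real_norm_sq_eq,
    EuclideanSpace.real_norm_sq_eq]
  refine Finset.sum_le_sum fun j _ => ?_
  simp only [coordRestrict]
  split_ifs
  · exact le_rfl
  · simpa using sq_nonneg (x j)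

theorem linComb_coordRestrict (Y : ι → Ω → E) (I : Finset ι) (x : EuclideanSpace ℝ ι) (ω : Ω) :
    linComb Y (coordRestrict I x) ω = ∑ j ∈ I, x j • Y j ω := by
  simp [linComb, coordRestrict, ite_smul, Finset.sum_ite_mem]

theorem MeasureTheory.MemLp.top_inner [MeasurableSpace Ω] {P : Measure Ω} {U V : Ω → E} (hU : MemLp U ∞ P) (hV : MemLp V ∞ P) :
    MemLp (fun ω => inner ℝ (U ω) (V ω)) ∞ P := by
  refine (hV.norm.mul (r := ∞) hU.norm).mono (hU.1.inner hV.1) (ae_of_all _ fun ω => ?_)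
  simpa using norm_inner_le_norm (𝕜 := ℝ) (U ω) (V ω)

end LinComb

/-! ### Chaos moments for independent unit columns -/

variable {Ω : Type*} [MeasurableSpace Ω] {P : Measure Ω}
  {E : Type*} [NormedAddCommGroup E] [InnerProductSpace ℝ E] [CompleteSpace E]
  [SecondCountableTopology E] [MeasurableSpace E] [BorelSpace E]
  {ι : Type*} [Fintype ι]

/-- Fubini on the product law: with `U` frozen, only one-dimensional marginals of `V` enter. -/
theorem ProbabilityTheory.IndepFun.integral_inner_pow_le [IsProbabilityMeasure P] {U V : Ω → E}
    (hUV : IndepFun U V P) (hU : MemLp U ∞ P) (hV : MemLp V ∞ P) {k : ℕ} {c : ℝ}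
    (h : ∀ u, ∫ ω, inner ℝ u (V ω) ^ (2 * k) ∂P ≤ c * ‖u‖ ^ (2 * k)) :
    ∫ ω, inner ℝ (U ω) (V ω) ^ (2 * k) ∂P ≤ c * ∫ ω, ‖U ω‖ ^ (2 * k) ∂P := by
  have hint : Integrable (fun ω => inner ℝ (U ω) (V ω) ^ (2 * k)) P :=
    ((hU.top_inner hV).top_pow _).integrable le_top
  have hUm := hU.1.aemeasurable
  have hVm := hV.1.aemeasurable
  have hmap := (indepFun_iff_map_prod_eq_prod_map_map hUm hVm).1 hUV
  have hUVm : AEMeasurable (fun ω => (U ω, V ω)) P := hUm.prodMk hVm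
  have hg : Continuous (fun p : E × E => inner ℝ p.1 p.2 ^ (2 * k)) := by fun_prop
  have := Measure.isProbabilityMeasure_map (μ := P) hUm
  have := Measure.isProbabilityMeasure_map (μ := P) hVm
  have hint2 : Integrable (fun p : E × E => inner ℝ p.1 p.2 ^ (2 * k))
      ((P.map U).prod (P.map V)) := by
    rw [← hmap]
    exact (integrable_map_measure hg.aestronglyMeasurable hUVm).2 hint
  calc ∫ ω, inner ℝ (U ω) (V ω) ^ (2 * k) ∂P
      = ∫ p, inner ℝ p.1 p.2 ^ (2 * k) ∂(P.map fun ω => (U ω, V ω)) :=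
        (integral_map hUVm hg.aestronglyMeasurable).symm
    _ = ∫ u, ∫ v, inner ℝ u v ^ (2 * k) ∂(P.map V) ∂(P.map U) := by
        rw [hmap, integral_prod _ hint2]
    _ ≤ ∫ u, c * ‖u‖ ^ (2 * k) ∂(P.map U) := by
        refine integral_mono hint2.integral_prod_left ?_ fun u => ?_
        · refine Integrable.const_mul ?_ _
          refine (integrable_map_measure (by fun_prop) hUm).2 ?_
          exact (hU.norm.top_pow _).integrable le_top
        · have hc : Continuous (fun v : E => inner ℝ u v ^ (2 * k)) := by fun_prop
          simp only
          rw [integral_map hVm hc.aestronglyMeasurable]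
          exact h u
    _ = c * ∫ ω, ‖U ω‖ ^ (2 * k) ∂P := by
        rw [integral_const_mul, integral_map hUm (by fun_prop)]

/-- Independent centred random unit vectors `Y_j` whose one-dimensional marginals have even
moments `E ⟪Y_j, w⟫ ^ (2 l) ≤ (σ * l ^ β * ‖w‖ ^ 2) ^ l`. -/
structure UnitVectorModel (P : Measure Ω) (Y : ι → Ω → E) (σ β : ℝ) : Prop where
  meas : ∀ j, Measurable (Y j)
  indep : iIndepFun Y P
  mean : ∀ j, ∫ ω, Y j ω ∂P = 0
  norm_eq : ∀ j, ∀ᵐ ω ∂P, ‖Y j ω‖ = 1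
  nonneg : 0 ≤ σ
  one_le : 1 ≤ β
  moment : ∀ j w (l : ℕ), 1 ≤ l →
    ∫ ω, inner ℝ (Y j ω) w ^ (2 * l) ∂P ≤ (σ * (l : ℝ) ^ β * ‖w‖ ^ 2) ^ l

namespace UnitVectorModel

variable {Y : ι → Ω → E} {σ β : ℝ} [IsProbabilityMeasure P]


theorem memLp (h : UnitVectorModel P Y σ β) (j : ι) : MemLp (Y j) ∞ P :=
  memLp_top_of_bound (h.meas j).aestronglyMeasurable 1 ((h.norm_eq j).mono fun _ hω => hω.le)

theorem memLp_linComb (h : UnitVectorModel P Y σ β) (x : EuclideanSpace ℝ ι) :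
    MemLp (linComb Y x) ∞ P :=
  memLp_finsetSum _ fun j _ => (h.memLp j).const_smul (x j)

theorem measurable_linComb (h : UnitVectorModel P Y σ β) (x : EuclideanSpace ℝ ι) :
    Measurable (linComb Y x) :=
  Finset.measurable_fun_sum _ fun j _ => (h.meas j).const_smul (x j)

theorem integral_linComb (h : UnitVectorModel P Y σ β) (x : EuclideanSpace ℝ ι) :
    ∫ ω, linComb Y x ω ∂P = 0 := by
  unfold linComb
  rw [integral_finsetSum (f := fun j ω => x j • Y j ω) _ fun j _ =>
    ((h.memLp j).const_smul (x j)).integrable le_top]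
  refine Finset.sum_eq_zero fun j _ => ?_
  rw [integral_smul, h.mean j, smul_zero]

/-- For `l ≤ k` one has `l^β ≤ l * k^(β - 1)`, so up to order `2k` the marginals look Gaussian with
variance inflated by `k^(β - 1)`, and the Khintchine bound truncated at `M = k` applies. The `8` is
its `4` times the `2` of `evenMomentCoeff_le`. -/
theorem integral_inner_linComb_pow_le (h : UnitVectorModel P Y σ β) (x : EuclideanSpace ℝ ι)
    (w : E) {k : ℕ} (hk : 1 ≤ k) :
    ∫ ω, inner ℝ (linComb Y x ω) w ^ (2 * k) ∂P
      ≤ (8 * σ * (k : ℝ) ^ β * (‖x‖ ^ 2 * ‖w‖ ^ 2)) ^ k := by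
  have hσ := h.nonneg
  have hb : ∀ j, MemLp (fun ω => x j * inner ℝ (Y j ω) w) ∞ P := fun j =>
    ((h.memLp j).top_inner (memLp_const w)).const_mul _
  have hk0 : (0 : ℝ) < k := by exact_mod_cast hk
  have key := integral_sum_pow_le (P := P) Finset.univ
    (ξ := fun j ω => x j * inner ℝ (Y j ω) w)
    (d := fun j => σ * (k : ℝ) ^ (β - 1) * ‖w‖ ^ 2 * x j ^ 2) (M := k)
    (fun j => ((h.meas j).inner measurable_const).const_mul _)
    (h.indep.comp (fun j y => x j * inner ℝ y w) fun j =>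
      (measurable_id.inner measurable_const).const_mul _)
    hb
    (fun j => by
      simp only [real_inner_comm w]
      rw [integral_const_mul, integral_inner ((h.memLp j).integrable le_top), h.mean j]
      simp)
    (fun j => by positivity)
    (fun j l hl => by
      rcases Nat.eq_zero_or_pos l with rfl | hl1
      · simp [evenMomentCoeff]
      have hl0 : (0 : ℝ) < l := by exact_mod_cast hl1
      simp only [mul_pow (x j)]
      rw [integral_const_mul]
      have h1 : (l : ℝ) ^ β ≤ l * (k : ℝ) ^ (β - 1) := by
        calc (l : ℝ) ^ β = l * (l : ℝ) ^ (β - 1) := by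
              rw [← Real.rpow_one_add' hl0.le (by linarith [h.one_le])]; ring_nf
          _ ≤ _ := by
              refine mul_le_mul_of_nonneg_left (Real.rpow_le_rpow hl0.le ?_ ?_) hl0.le
              · exact_mod_cast hl
              · linarith [h.one_le]
      calc x j ^ (2 * l) * ∫ ω, inner ℝ (Y j ω) w ^ (2 * l) ∂P
          ≤ x j ^ (2 * l) * (σ * (l * (k : ℝ) ^ (β - 1)) * ‖w‖ ^ 2) ^ l := by
            refine mul_le_mul_of_nonneg_left ((h.moment j w l hl1).trans ?_)
              ((even_two_mul l).pow_nonneg _)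
            gcongr
        _ = (l : ℝ) ^ l * (σ * (k : ℝ) ^ (β - 1) * ‖w‖ ^ 2 * x j ^ 2) ^ l := by
            rw [pow_mul, ← mul_pow, ← mul_pow]; ring
        _ ≤ _ := mul_le_mul_of_nonneg_right (pow_self_le_evenMomentCoeff l) (by positivity))
    k le_rfl
  have e : ∀ ω, inner ℝ (linComb Y x ω) w = ∑ j, x j * inner ℝ (Y j ω) w := fun ω => by
    simp [linComb, sum_inner, real_inner_smul_left]
  simp only [e]
  refine key.trans ((mul_le_mul_of_nonneg_right (evenMomentCoeff_le k) ?_).trans_eq ?_)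
  · have : 0 ≤ ∑ j, σ * (k : ℝ) ^ (β - 1) * ‖w‖ ^ 2 * x j ^ 2 :=
      Finset.sum_nonneg fun j _ => by positivity
    positivity
  · rw [← mul_pow, ← Finset.mul_sum, ← EuclideanSpace.real_norm_sq_eq]
    have : (k : ℝ) ^ β = k * (k : ℝ) ^ (β - 1) := by
      rw [← Real.rpow_one_add' hk0.le (by linarith [h.one_le])]; ring_nf
    rw [this]; ring

theorem indepFun_linComb (h : UnitVectorModel P Y σ β) [DecidableEq ι] (I : Finset ι)
    (u v : EuclideanSpace ℝ ι) :
    IndepFun (linComb Y (coordRestrict I u)) (linComb Y (coordRestrict Iᶜ v)) P := by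
  have h1 := h.indep.indepFun_finset I Iᶜ disjoint_compl_right h.meas
  have h2 := h1.comp (φ := fun y : I → E => ∑ j : I, u j • y j)
    (ψ := fun y : (Iᶜ : Finset ι) → E => ∑ j : (Iᶜ : Finset ι), v j • y j)
    (Finset.measurable_fun_sum _ fun j _ => (measurable_pi_apply j).const_smul _)
    (Finset.measurable_fun_sum _ fun j _ => (measurable_pi_apply j).const_smul _)
  convert h2 using 1
  · ext1 ω
    rw [linComb_coordRestrict]
    exact (Finset.sum_coe_sort I fun j => u j • Y j ω).symm
  · ext1 ω
    rw [linComb_coordRestrict]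
    exact (Finset.sum_coe_sort Iᶜ fun j => v j • Y j ω).symm

/-- Unit norms make the diagonal exactly `⟪u, v⟫`; what remains is off-diagonal and decouples. -/
theorem ae_inner_linComb_sub (h : UnitVectorModel P Y σ β) [DecidableEq ι]
    (u v : EuclideanSpace ℝ ι) :
    ∀ᵐ ω ∂P, inner ℝ (linComb Y u ω) (linComb Y v ω) - inner ℝ u v
      = ∑ I : Finset ι, ((2 : ℝ) ^ Fintype.card ι)⁻¹ *
        (4 * inner ℝ (linComb Y (coordRestrict I u) ω) (linComb Y (coordRestrict Iᶜ v) ω)) := by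
  filter_upwards [ae_all_iff.2 h.norm_eq] with ω hω
  have e := sum_offDiag_eq_average fun i j => inner ℝ (u i • Y i ω) (v j • Y j ω)
  have e2 : ∀ I : Finset ι,
      inner ℝ (linComb Y (coordRestrict I u) ω) (linComb Y (coordRestrict Iᶜ v) ω)
      = ∑ i ∈ I, ∑ j ∈ Iᶜ, inner ℝ (u i • Y i ω) (v j • Y j ω) := fun I => by
    simp only [linComb_coordRestrict, sum_inner, inner_sum]
    exact Finset.sum_comm
  simp only [e2]
  rw [← e]
  have e3 : inner ℝ (linComb Y u ω) (linComb Y v ω)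
      = ∑ i, ∑ j, inner ℝ (u i • Y i ω) (v j • Y j ω) := by
    simp only [linComb, sum_inner, inner_sum]
    exact Finset.sum_comm
  have e4 : inner ℝ u v = ∑ i, inner ℝ (u i • Y i ω) (v i • Y i ω) := by
    simp only [PiLp.inner_apply, real_inner_smul_left, real_inner_smul_right,
      real_inner_self_eq_norm_sq, hω]
    refine Finset.sum_congr rfl fun i _ => ?_
    simp [mul_comm]
  rw [e3, e4, ← Finset.sum_sub_distrib]
  refine Finset.sum_congr rfl fun i _ => ?_
  rw [sub_eq_iff_eq_add, ← Finset.sum_add_sum_compl {i}, add_comm, Finset.sum_singleton,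
    ← Finset.sum_add_sum_compl {i} (fun j => if i = j then 0 else _)]
  simp only [Finset.sum_singleton, if_true, zero_add]
  congr 1
  refine Finset.sum_congr rfl fun j hj => ?_
  rw [if_neg]
  rintro rfl
  simp at hj

theorem integral_inner_linComb (h : UnitVectorModel P Y σ β) (u v : EuclideanSpace ℝ ι) :
    ∫ ω, inner ℝ (linComb Y u ω) (linComb Y v ω) ∂P = inner ℝ u v := by
  classical
  have hint : ∀ u v : EuclideanSpace ℝ ι,
      Integrable (fun ω => inner ℝ (linComb Y u ω) (linComb Y v ω)) P := fun u v =>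
    ((h.memLp_linComb u).top_inner (h.memLp_linComb v)).integrable le_top
  have h1 : ∫ ω, (inner ℝ (linComb Y u ω) (linComb Y v ω) - inner ℝ u v) ∂P = 0 := by
    rw [integral_congr_ae (h.ae_inner_linComb_sub u v),
      integral_finsetSum _ fun I _ => ((hint _ _).const_mul _).const_mul _]
    refine Finset.sum_eq_zero fun I _ => ?_
    have : ∫ ω, inner ℝ (linComb Y (coordRestrict I u) ω) (linComb Y (coordRestrict Iᶜ v) ω) ∂P
        = inner ℝ (∫ ω, linComb Y (coordRestrict I u) ω ∂P)
          (∫ ω, linComb Y (coordRestrict Iᶜ v) ω ∂P) :=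
      (h.indepFun_linComb I u v).integral_bilin
        ((h.memLp_linComb _).integrable le_top) ((h.memLp_linComb _).integrable le_top) (innerSL ℝ)
    rw [integral_const_mul, integral_const_mul, this, h.integral_linComb, inner_zero_left]; simp
  rw [integral_sub (hint u v) (integrable_const _), integral_const] at h1
  simpa [sub_eq_zero] using h1

/-- Jensen moves the power inside the average over `I`; each term pairs independent factors, the
second handled through its marginals and the first through `N`. The `16` is the squared decoupling
factor `4`. -/
theorem integral_chaos_pow_le_of_norm (h : UnitVectorModel P Y σ β) (u v : EuclideanSpace ℝ ι)
    {k : ℕ} (hk : 1 ≤ k) {N : ℝ}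
    (hN : ∀ I : Finset ι, ∫ ω, ‖linComb Y (coordRestrict I u) ω‖ ^ (2 * k) ∂P ≤ N) :
    ∫ ω, (inner ℝ (linComb Y u ω) (linComb Y v ω) - inner ℝ u v) ^ (2 * k) ∂P
      ≤ (16 * (8 * σ * (k : ℝ) ^ β) * ‖v‖ ^ 2) ^ k * N := by
  classical
  have hσ := h.nonneg
  set D : Finset ι → Ω → ℝ := fun I ω =>
    inner ℝ (linComb Y (coordRestrict I u) ω) (linComb Y (coordRestrict Iᶜ v) ω) with hD
  have hDm : ∀ I, MemLp (fun ω => (4 * D I ω) ^ (2 * k)) ∞ P := fun I =>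
    ((((h.memLp_linComb _).top_inner (h.memLp_linComb _))).const_mul 4).top_pow _
  have hDb : ∀ I, ∫ ω, (4 * D I ω) ^ (2 * k) ∂P
      ≤ (16 * (8 * σ * (k : ℝ) ^ β) * ‖v‖ ^ 2) ^ k * N := fun I => by
    have h1 := (h.indepFun_linComb I u v).integral_inner_pow_le (h.memLp_linComb _)
      (h.memLp_linComb _) (k := k) (c := (8 * σ * (k : ℝ) ^ β * ‖v‖ ^ 2) ^ k) fun w => by
        have := h.integral_inner_linComb_pow_le (coordRestrict Iᶜ v) w hk
        refine le_trans (le_of_eq ?_) (this.trans ?_)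
        · exact integral_congr_ae (ae_of_all _ fun ω => by
            simp only; rw [real_inner_comm])
        have h3 := norm_coordRestrict_le Iᶜ v
        rw [pow_mul ‖w‖, ← mul_pow _ (‖w‖ ^ 2) k, ← mul_assoc]
        gcongr
    have hs : ∀ ω, (4 * D I ω) ^ (2 * k) = 16 ^ k * D I ω ^ (2 * k) := fun ω => by
      rw [mul_pow, pow_mul 4]; norm_num
    simp only [hs]
    rw [integral_const_mul]
    calc 16 ^ k * ∫ ω, D I ω ^ (2 * k) ∂P
        ≤ 16 ^ k * ((8 * σ * (k : ℝ) ^ β * ‖v‖ ^ 2) ^ k * N) := by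
          refine mul_le_mul_of_nonneg_left (h1.trans ?_) (by positivity)
          exact mul_le_mul_of_nonneg_left (hN I) (by positivity)
      _ = _ := by rw [← mul_assoc, ← mul_pow]; ring
  have hw : ∑ _I : Finset ι, ((2 : ℝ) ^ Fintype.card ι)⁻¹ = 1 := by
    rw [Finset.sum_const, Finset.card_univ, Fintype.card_finset, nsmul_eq_mul]
    push_cast
    exact mul_inv_cancel₀ (by positivity)
  calc ∫ ω, (inner ℝ (linComb Y u ω) (linComb Y v ω) - inner ℝ u v) ^ (2 * k) ∂P
      ≤ ∫ ω, ∑ I : Finset ι, ((2 : ℝ) ^ Fintype.card ι)⁻¹ * (4 * D I ω) ^ (2 * k) ∂P := by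
        refine integral_mono_ae ?_
          (integrable_finsetSum _ fun I _ => ((hDm I).integrable le_top).const_mul _) ?_
        · have h1 : MemLp (fun ω => inner ℝ (linComb Y u ω) (linComb Y v ω) - inner ℝ u v) ∞ P :=
            ((h.memLp_linComb _).top_inner (h.memLp_linComb _)).sub (memLp_const _)
          exact (h1.top_pow _).integrable le_top
        · filter_upwards [h.ae_inner_linComb_sub u v] with ω hω
          rw [hω]
          exact Real.pow_arith_mean_le_arith_mean_pow_of_even _ _ _ (fun _ _ => by positivity) hw
            (even_two_mul k)
    _ = ∑ I : Finset ι, ((2 : ℝ) ^ Fintype.card ι)⁻¹ * ∫ ω, (4 * D I ω) ^ (2 * k) ∂P := by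
        rw [integral_finsetSum _ fun I _ => ((hDm I).integrable le_top).const_mul _]
        simp only [integral_const_mul]
    _ ≤ ∑ I : Finset ι, ((2 : ℝ) ^ Fintype.card ι)⁻¹ *
          ((16 * (8 * σ * (k : ℝ) ^ β) * ‖v‖ ^ 2) ^ k * N) :=
        Finset.sum_le_sum fun I _ => mul_le_mul_of_nonneg_left (hDb I) (by positivity)
    _ = _ := by rw [← Finset.sum_mul, hw, one_mul]

end UnitVectorModel

end

/-! ### Moments of norms and of their increments -/

section

theorem add_pow_two_mul_le (a b : ℝ) (k : ℕ) :
    (a + b) ^ (2 * k) ≤ 4 ^ k * (a ^ (2 * k) + b ^ (2 * k)) := by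
  have h1 : (a + b) ^ 2 ≤ 2 * (a ^ 2 + b ^ 2) := by nlinarith [sq_nonneg (a - b)]
  calc (a + b) ^ (2 * k) = ((a + b) ^ 2) ^ k := pow_mul _ _ _
    _ ≤ (2 * (a ^ 2 + b ^ 2)) ^ k := by gcongr
    _ = 2 ^ k * (a ^ 2 + b ^ 2) ^ k := mul_pow _ _ _
    _ ≤ 2 ^ k * (2 ^ (k - 1) * ((a ^ 2) ^ k + (b ^ 2) ^ k)) := by
        gcongr; exact add_pow_le (sq_nonneg a) (sq_nonneg b) k
    _ ≤ 2 ^ k * (2 ^ k * ((a ^ 2) ^ k + (b ^ 2) ^ k)) := by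
        gcongr
        · norm_num
        · omega
    _ = _ := by
        rw [← pow_mul, ← pow_mul, ← mul_assoc, ← mul_pow]; norm_num

variable {Ω : Type*} [MeasurableSpace Ω] {P : Measure Ω}

theorem integral_mul_le_of_integral_sq_le [IsFiniteMeasure P] {f g : Ω → ℝ} (hf : MemLp f ∞ P)
    (hg : MemLp g ∞ P) (hf0 : ∀ ω, 0 ≤ f ω) (hg0 : ∀ ω, 0 ≤ g ω) {a b : ℝ} (ha : 0 ≤ a)
    (hb : 0 ≤ b) (hfa : ∫ ω, f ω ^ 2 ∂P ≤ a ^ 2) (hgb : ∫ ω, g ω ^ 2 ∂P ≤ b ^ 2) :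
    ∫ ω, f ω * g ω ∂P ≤ a * b := by
  have hpq : Real.HolderConjugate 2 2 := by
    rw [Real.holderConjugate_iff]; norm_num
  have h := integral_mul_le_Lp_mul_Lq_of_nonneg (μ := P) hpq (ae_of_all _ hf0) (ae_of_all _ hg0)
    (hf.mono_exponent le_top) (hg.mono_exponent le_top)
  simp only [Real.rpow_two, ← Real.sqrt_eq_rpow] at h
  refine h.trans (mul_le_mul ?_ ?_ (Real.sqrt_nonneg _) ha)
  · exact Real.sqrt_le_iff.2 ⟨ha, hfa⟩
  · exact Real.sqrt_le_iff.2 ⟨hb, hgb⟩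

/-- Dividing `a^2 - b^2` by `a + b` costs a factor `2` when `a ≥ 1/2`. Otherwise `|W| ≥ 3/4`, so the
trivial bound `N` can afford that extra factor. -/
theorem abs_sub_le_of_unit_scale {a b I N W : ℝ} (ha : 0 ≤ a) (hb : 0 ≤ b)
    (hI : a ^ 2 - b ^ 2 = I) (hN : |a - b| ≤ N) (hW : a ^ 2 - 1 = W) :
    |a - b| ≤ 2 * |I| + 4 / 3 * (N * |W|) := by
  have hN0 : 0 ≤ N := (abs_nonneg _).trans hN
  rcases le_or_gt (1 / 2) a with h | h
  · have h1 : |I| = |a - b| * (a + b) := by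
      rw [← hI, show a ^ 2 - b ^ 2 = (a - b) * (a + b) by ring, abs_mul,
        abs_of_nonneg (add_nonneg ha hb)]
    have h2 : |a - b| * (1 / 2) ≤ |a - b| * (a + b) :=
      mul_le_mul_of_nonneg_left (by linarith) (abs_nonneg _)
    have h3 : 0 ≤ N * |W| := by positivity
    linarith
  · have h1 : 3 / 4 ≤ |W| := by
      rw [← hW, abs_of_nonpos (by nlinarith)]; nlinarith
    have h2 : N * (3 / 4) ≤ N * |W| := mul_le_mul_of_nonneg_left h1 hN0
    have h3 := abs_nonneg I
    linarith

theorem norm_mul_norm_normalize_sub_le {F : Type*} [NormedAddCommGroup F] [NormedSpace ℝ F]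
    {x y : F} (hx : x ≠ 0) (hy : y ≠ 0) :
    ‖y‖ * ‖‖x‖⁻¹ • x - ‖y‖⁻¹ • y‖ ≤ 2 * ‖x - y‖ := by
  have hx' : ‖x‖ ≠ 0 := norm_ne_zero_iff.2 hx
  have hy' : ‖y‖ ≠ 0 := norm_ne_zero_iff.2 hy
  have e : ‖y‖ • (‖x‖⁻¹ • x - ‖y‖⁻¹ • y) = (x - y) + (‖y‖ - ‖x‖) • (‖x‖⁻¹ • x) := by
    rw [smul_sub, smul_smul ‖y‖ ‖y‖⁻¹, mul_inv_cancel₀ hy', one_smul, sub_smul, smul_smul ‖x‖,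
      mul_inv_cancel₀ hx', one_smul]
    abel
  calc ‖y‖ * ‖‖x‖⁻¹ • x - ‖y‖⁻¹ • y‖ = ‖‖y‖ • (‖x‖⁻¹ • x - ‖y‖⁻¹ • y)‖ := by
        rw [norm_smul, norm_norm]
    _ ≤ ‖x - y‖ + ‖(‖y‖ - ‖x‖) • (‖x‖⁻¹ • x)‖ := by rw [e]; exact norm_add_le _ _
    _ = ‖x - y‖ + |‖y‖ - ‖x‖| := by
        rw [norm_smul, norm_smul, norm_inv, norm_norm, inv_mul_cancel₀ hx', mul_one,
          Real.norm_eq_abs]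
    _ ≤ _ := by
        have := abs_norm_sub_norm_le y x
        rw [norm_sub_rev] at this
        linarith

variable {E : Type*} [NormedAddCommGroup E] [InnerProductSpace ℝ E] [CompleteSpace E]
  [SecondCountableTopology E] [MeasurableSpace E] [BorelSpace E]
  {ι : Type*} [Fintype ι]

namespace UnitVectorModel

variable {Y : ι → Ω → E} {σ β : ℝ} [IsProbabilityMeasure P]

/-- The scale of the `2 k`-th moments. -/
noncomputable def scale (σ β : ℝ) (k : ℕ) : ℝ := 8 * σ * (k : ℝ) ^ β

theorem scale_nonneg (h : UnitVectorModel P Y σ β) (k : ℕ) : 0 ≤ scale σ β k := by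
  have := h.nonneg
  unfold scale; positivity

theorem scale_mono (h : UnitVectorModel P Y σ β) : Monotone (scale σ β) := fun k l hkl => by
  have := h.nonneg
  have hβ : 0 ≤ β := by linarith [h.one_le]
  unfold scale
  gcongr

theorem memLp_chaos (h : UnitVectorModel P Y σ β) (u v : EuclideanSpace ℝ ι) :
    MemLp (fun ω => inner ℝ (linComb Y u ω) (linComb Y v ω) - inner ℝ u v) ∞ P :=
  ((h.memLp_linComb _).top_inner (h.memLp_linComb _)).sub (memLp_const _)

/-- Bootstrap by doubling the order: the squared norm is `‖u‖^2` plus a chaos, whose `2k`-th moment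
needs only the `2k`-th moment of the norm. -/
theorem integral_norm_pow_le (h : UnitVectorModel P Y σ β) (r : ℕ) (u : EuclideanSpace ℝ ι) :
    ∫ ω, ‖linComb Y u ω‖ ^ (2 * 2 ^ r) ∂P
      ≤ (65 * (1 + scale σ β (2 ^ r)) * ‖u‖ ^ 2) ^ (2 ^ r) := by
  induction r generalizing u with
  | zero =>
    have := h.integral_inner_linComb u u
    simp only [real_inner_self_eq_norm_sq] at this
    simp only [pow_zero, mul_one, pow_one, this]
    have h1 := h.scale_nonneg 1
    nlinarith [sq_nonneg ‖u‖, mul_nonneg h1 (sq_nonneg ‖u‖)]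
  | succ r ih =>
    set k := 2 ^ r with hk
    have hk1 : 1 ≤ k := Nat.one_le_two_pow
    have hk2 : 2 ^ (r + 1) = 2 * k := by rw [pow_succ, mul_comm]
    rw [hk2]
    set q := scale σ β k
    have hq : 0 ≤ q := h.scale_nonneg k
    have hqq : q ≤ scale σ β (2 * k) := h.scale_mono (by omega)
    have hch := h.integral_chaos_pow_le_of_norm u u hk1
      (N := (65 * (1 + q) * ‖u‖ ^ 2) ^ k) fun I => (ih _).trans <| by
        have := norm_coordRestrict_le I u
        gcongr
    have hp : ∀ ω, ‖linComb Y u ω‖ ^ (2 * (2 * k)) ≤ 4 ^ k *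
        ((inner ℝ (linComb Y u ω) (linComb Y u ω) - inner ℝ u u) ^ (2 * k)
          + (‖u‖ ^ 2) ^ (2 * k)) := fun ω => by
      have := add_pow_two_mul_le
        (inner ℝ (linComb Y u ω) (linComb Y u ω) - inner ℝ u u) (‖u‖ ^ 2) k
      rw [real_inner_self_eq_norm_sq, real_inner_self_eq_norm_sq] at this ⊢
      rwa [sub_add_cancel, ← pow_mul ‖linComb Y u ω‖] at this
    have hi := ((h.memLp_chaos u u).top_pow (2 * k)).integrable le_top
    calc ∫ ω, ‖linComb Y u ω‖ ^ (2 * (2 * k)) ∂P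
        ≤ ∫ ω, 4 ^ k * ((inner ℝ (linComb Y u ω) (linComb Y u ω) - inner ℝ u u) ^ (2 * k)
          + (‖u‖ ^ 2) ^ (2 * k)) ∂P :=
          integral_mono (((h.memLp_linComb u).norm.top_pow _).integrable le_top)
            ((hi.add (integrable_const _)).const_mul _) hp
      _ = 4 ^ k * ((∫ ω, (inner ℝ (linComb Y u ω) (linComb Y u ω) - inner ℝ u u) ^ (2 * k) ∂P)
          + (‖u‖ ^ 2) ^ (2 * k)) := by
          rw [integral_const_mul, integral_add hi (integrable_const _)]; simp
      _ ≤ 4 ^ k * ((16 * q * ‖u‖ ^ 2) ^ k * (65 * (1 + q) * ‖u‖ ^ 2) ^ k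
          + (‖u‖ ^ 2) ^ (2 * k)) := by
          gcongr
          exact hch
      _ = (‖u‖ ^ 2) ^ (2 * k) * (4 ^ k * ((16 * q * (65 * (1 + q))) ^ k + 1 ^ k)) := by
          rw [one_pow, pow_mul (‖u‖ ^ 2) 2 k]
          simp only [mul_pow]; ring
      _ ≤ (‖u‖ ^ 2) ^ (2 * k) * (4 ^ k * (16 * q * (65 * (1 + q)) + 1) ^ k) := by
          gcongr
          exact pow_add_pow_le (by positivity) zero_le_one (by omega)
      _ = (‖u‖ ^ 2) ^ (2 * k) * (4 * (16 * q * (65 * (1 + q)) + 1)) ^ k := by rw [← mul_pow 4]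
      -- The induction closes because `65` exceeds `4 * 16`, the factor produced by one doubling.
      _ ≤ (‖u‖ ^ 2) ^ (2 * k) * ((65 * (1 + q)) ^ 2) ^ k := by
          gcongr
          nlinarith
      _ = (65 * (1 + q) * ‖u‖ ^ 2) ^ (2 * k) := by
          rw [← pow_mul (65 * (1 + q)), ← mul_pow, mul_comm]
      _ ≤ _ := by gcongr

theorem integral_chaos_pow_le (h : UnitVectorModel P Y σ β) (r : ℕ) (u v : EuclideanSpace ℝ ι) :
    ∫ ω, (inner ℝ (linComb Y u ω) (linComb Y v ω) - inner ℝ u v) ^ (2 * 2 ^ r) ∂P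
      ≤ (1040 * (scale σ β (2 ^ r) * (1 + scale σ β (2 ^ r))) * (‖u‖ ^ 2 * ‖v‖ ^ 2)) ^ (2 ^ r) := by
  have hq := h.scale_nonneg (2 ^ r)
  refine (h.integral_chaos_pow_le_of_norm u v Nat.one_le_two_pow
    (N := (65 * (1 + scale σ β (2 ^ r)) * ‖u‖ ^ 2) ^ 2 ^ r) fun I =>
      (h.integral_norm_pow_le r _).trans ?_).trans_eq ?_
  · have := norm_coordRestrict_le I u
    gcongr
  · rw [← mul_pow]; unfold scale; push_cast; ring

/-- Linearity in the scale `q` is the point. For `q ≥ 1` the norm moments suffice; for `q < 1`, `|a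
- 1| ≤ |a^2 - 1|` reduces to the chaos, where `q (1 + q) ≤ 2q`. -/
theorem integral_norm_sub_one_pow_le (h : UnitVectorModel P Y σ β) (r : ℕ)
    {x : EuclideanSpace ℝ ι} (hx : ‖x‖ = 1) :
    ∫ ω, (‖linComb Y x ω‖ - 1) ^ (2 * 2 ^ r) ∂P ≤ (2080 * scale σ β (2 ^ r)) ^ (2 ^ r) := by
  have hN := h.integral_norm_pow_le r x
  have hC := h.integral_chaos_pow_le r x x
  set k := 2 ^ r
  have hk1 : 1 ≤ k := Nat.one_le_two_pow
  have hq := h.scale_nonneg k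
  set q := scale σ β k
  simp only [hx, real_inner_self_eq_norm_sq, one_pow, mul_one] at hN hC
  have hi : Integrable (fun ω => ‖linComb Y x ω‖ ^ (2 * k)) P :=
    ((h.memLp_linComb x).norm.top_pow _).integrable le_top
  have hi1 : Integrable (fun ω => (‖linComb Y x ω‖ - 1) ^ (2 * k)) P :=
    (((h.memLp_linComb x).norm.sub (memLp_const 1)).top_pow _).integrable le_top
  rcases le_or_gt 1 q with h1 | h1
  · calc ∫ ω, (‖linComb Y x ω‖ - 1) ^ (2 * k) ∂P
        ≤ ∫ ω, 4 ^ k * (‖linComb Y x ω‖ ^ (2 * k) + 1) ∂P := by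
          refine integral_mono hi1 ((hi.add (integrable_const _)).const_mul _) fun ω => ?_
          have := add_pow_two_mul_le ‖linComb Y x ω‖ (-1) k
          rwa [(even_two_mul k).neg_one_pow, ← sub_eq_add_neg] at this
      _ = 4 ^ k * ((∫ ω, ‖linComb Y x ω‖ ^ (2 * k) ∂P) + 1) := by
          rw [integral_const_mul, integral_add hi (integrable_const _)]; simp
      _ ≤ 4 ^ k * ((65 * (1 + q)) ^ k + 1 ^ k) := by rw [one_pow]; gcongr
      _ ≤ 4 ^ k * (65 * (1 + q) + 1) ^ k := by
          gcongr; exact pow_add_pow_le (by positivity) zero_le_one (by omega)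
      _ = (4 * (65 * (1 + q) + 1)) ^ k := by rw [← mul_pow]
      _ ≤ _ := pow_le_pow_left₀ (by positivity) (by linarith) _
  · calc ∫ ω, (‖linComb Y x ω‖ - 1) ^ (2 * k) ∂P
        ≤ ∫ ω, (‖linComb Y x ω‖ ^ 2 - 1) ^ (2 * k) ∂P := by
          refine integral_mono hi1 ?_ fun ω => ?_
          · exact ((((h.memLp_linComb x).norm.top_pow 2).sub
              (memLp_const 1)).top_pow _).integrable le_top
          · simp only
            rw [pow_mul, pow_mul (‖linComb Y x ω‖ ^ 2 - 1)]
            refine pow_le_pow_left₀ (sq_nonneg _) ?_ _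
            have : 0 ≤ ‖linComb Y x ω‖ := norm_nonneg _
            rw [show ‖linComb Y x ω‖ ^ 2 - 1
              = (‖linComb Y x ω‖ - 1) * (‖linComb Y x ω‖ + 1) by ring, mul_pow]
            exact le_mul_of_one_le_right (sq_nonneg _) (one_le_pow₀ (by linarith))
      _ ≤ _ := hC
      _ ≤ _ := by
          refine pow_le_pow_left₀ (by positivity) ?_ _
          nlinarith

/-- The same split on `q`. For `q < 1`, unit norms make `x - y` orthogonal to `x + y`, so the
difference of squares is a centred chaos. The scale sits at the doubled order because Cauchy–Schwarz
separates `N` from `W`. -/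
theorem integral_norm_sub_norm_pow_le_of_unit (h : UnitVectorModel P Y σ β) (r : ℕ)
    {x y : EuclideanSpace ℝ ι} (hx : ‖x‖ = 1) (hy : ‖y‖ = 1) :
    ∫ ω, (‖linComb Y x ω‖ - ‖linComb Y y ω‖) ^ (2 * 2 ^ r) ∂P
      ≤ (2400000 * scale σ β (2 * 2 ^ r) * ‖x - y‖ ^ 2) ^ (2 ^ r) := by
  have hN := h.integral_norm_pow_le r (x - y)
  have hC := h.integral_chaos_pow_le r (x - y) (x + y)
  have hN2 := h.integral_norm_pow_le (r + 1) (x - y)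
  have hC2 := h.integral_chaos_pow_le (r + 1) x x
  rw [pow_succ, mul_comm (2 ^ r) 2] at hN2 hC2
  set k := 2 ^ r
  have hk1 : 1 ≤ k := Nat.one_le_two_pow
  have hqk := h.scale_nonneg k
  have hqq : scale σ β k ≤ scale σ β (2 * k) := h.scale_mono (by omega)
  have hq := h.scale_nonneg (2 * k)
  set q' := scale σ β k
  set q := scale σ β (2 * k)
  set t := ‖x - y‖
  have ht : 0 ≤ t := norm_nonneg _
  have hperp : inner ℝ (x - y) (x + y) = 0 := by
    rw [inner_sub_left, inner_add_right, inner_add_right, real_inner_self_eq_norm_sq,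
      real_inner_self_eq_norm_sq, hx, hy, real_inner_comm]; ring
  have hxy : ‖x + y‖ ≤ 2 := (norm_add_le _ _).trans (by rw [hx, hy]; norm_num)
  have hMx := (h.memLp_linComb x).norm
  have hMy := (h.memLp_linComb y).norm
  have hMd := (h.memLp_linComb (x - y)).norm
  have hi0 : Integrable (fun ω => (‖linComb Y x ω‖ - ‖linComb Y y ω‖) ^ (2 * k)) P :=
    ((hMx.sub hMy).top_pow _).integrable le_top
  have hd : ∀ ω, |‖linComb Y x ω‖ - ‖linComb Y y ω‖| ≤ ‖linComb Y (x - y) ω‖ := fun ω => by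
    rw [linComb_sub]; exact abs_norm_sub_norm_le _ _
  rcases le_or_gt 1 q with h1 | h1
  · calc ∫ ω, (‖linComb Y x ω‖ - ‖linComb Y y ω‖) ^ (2 * k) ∂P
        ≤ ∫ ω, ‖linComb Y (x - y) ω‖ ^ (2 * k) ∂P := by
          refine integral_mono hi0 ((hMd.top_pow _).integrable le_top) fun ω => ?_
          simp only
          rw [← (even_two_mul k).pow_abs]
          exact pow_le_pow_left₀ (abs_nonneg _) (hd ω) _
      _ ≤ (65 * (1 + q') * t ^ 2) ^ k := hN
      _ ≤ _ := by
          refine pow_le_pow_left₀ (by positivity) ?_ _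
          exact mul_le_mul_of_nonneg_right (by linarith) (sq_nonneg _)
  simp only [hx, real_inner_self_eq_norm_sq, one_pow, mul_one] at hC2
  rw [hperp] at hC
  simp only [sub_zero] at hC
  set I : Ω → ℝ := fun ω => inner ℝ (linComb Y (x - y) ω) (linComb Y (x + y) ω) with hI
  set N : Ω → ℝ := fun ω => ‖linComb Y (x - y) ω‖ with hNdef
  set W : Ω → ℝ := fun ω => ‖linComb Y x ω‖ ^ 2 - 1 with hW
  have hMI : MemLp I ∞ P := (h.memLp_linComb _).top_inner (h.memLp_linComb _)
  have hMW : MemLp W ∞ P := (hMx.top_pow 2).sub (memLp_const 1)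
  have hI1 : ∫ ω, I ω ^ (2 * k) ∂P ≤ (8320 * q * t ^ 2) ^ k := by
    refine hC.trans (pow_le_pow_left₀ (by positivity) ?_ _)
    calc 1040 * (q' * (1 + q')) * (t ^ 2 * ‖x + y‖ ^ 2)
        ≤ 1040 * (q * (1 + 1)) * (t ^ 2 * 2 ^ 2) := by gcongr; linarith
      _ = _ := by ring
  have hNW : ∫ ω, N ω ^ (2 * k) * W ω ^ (2 * k) ∂P ≤ (130 * t ^ 2) ^ k * (2080 * q) ^ k := by
    refine integral_mul_le_of_integral_sq_le (hMd.top_pow _) (hMW.top_pow _)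
      (fun ω => (even_two_mul k).pow_nonneg _) (fun ω => (even_two_mul k).pow_nonneg _)
      (by positivity) (by positivity) ?_ ?_
    · simp only [← pow_mul]
      rw [show 2 * k * 2 = 2 * (2 * k) by ring, show k * 2 = 2 * k by ring]
      refine hN2.trans (pow_le_pow_left₀ (by positivity) ?_ _)
      nlinarith [sq_nonneg t]
    · simp only [← pow_mul]
      rw [show 2 * k * 2 = 2 * (2 * k) by ring, show k * 2 = 2 * k by ring]
      refine hC2.trans (pow_le_pow_left₀ (by positivity) ?_ _)
      nlinarith
  have hpt : ∀ ω, (‖linComb Y x ω‖ - ‖linComb Y y ω‖) ^ (2 * k)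
      ≤ 16 ^ k * I ω ^ (2 * k) + 8 ^ k * (N ω ^ (2 * k) * W ω ^ (2 * k)) := fun ω => by
    have hIω : ‖linComb Y x ω‖ ^ 2 - ‖linComb Y y ω‖ ^ 2 = I ω := by
      simp only [hI]
      rw [linComb_sub, linComb_add, inner_sub_left, inner_add_right, inner_add_right,
        real_inner_self_eq_norm_sq, real_inner_self_eq_norm_sq,
        real_inner_comm (linComb Y x ω) (linComb Y y ω)]; ring
    have h2 := abs_sub_le_of_unit_scale (norm_nonneg _) (norm_nonneg _) hIω (hd ω)
      (rfl : _ = W ω)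
    calc (‖linComb Y x ω‖ - ‖linComb Y y ω‖) ^ (2 * k)
        = |‖linComb Y x ω‖ - ‖linComb Y y ω‖| ^ (2 * k) := ((even_two_mul k).pow_abs _).symm
      _ ≤ (2 * |I ω| + 4 / 3 * (N ω * |W ω|)) ^ (2 * k) := by gcongr
      _ ≤ 4 ^ k * ((2 * |I ω|) ^ (2 * k) + (4 / 3 * (N ω * |W ω|)) ^ (2 * k)) :=
          add_pow_two_mul_le _ _ _
      _ = 16 ^ k * I ω ^ (2 * k) + (64 / 9) ^ k * (N ω ^ (2 * k) * W ω ^ (2 * k)) := by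
          rw [mul_pow 2, mul_pow (4 / 3), mul_pow (N ω), (even_two_mul k).pow_abs,
            (even_two_mul k).pow_abs, pow_mul 2, pow_mul (4 / 3), mul_add, ← mul_assoc, ← mul_pow,
            ← mul_assoc (4 ^ k), ← mul_pow]
          norm_num
      _ ≤ _ := by
          gcongr
          · exact mul_nonneg ((even_two_mul k).pow_nonneg _) ((even_two_mul k).pow_nonneg _)
          · norm_num
  have i1 : Integrable (fun ω => 16 ^ k * I ω ^ (2 * k)) P :=
    ((hMI.top_pow _).integrable le_top).const_mul _
  have i2 : Integrable (fun ω => 8 ^ k * (N ω ^ (2 * k) * W ω ^ (2 * k))) P :=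
    (((hMd.top_pow _).top_mul (hMW.top_pow _)).integrable le_top).const_mul _
  calc ∫ ω, (‖linComb Y x ω‖ - ‖linComb Y y ω‖) ^ (2 * k) ∂P
      ≤ ∫ ω, (16 ^ k * I ω ^ (2 * k) + 8 ^ k * (N ω ^ (2 * k) * W ω ^ (2 * k))) ∂P :=
        integral_mono hi0 (i1.add i2) hpt
    _ = 16 ^ k * ∫ ω, I ω ^ (2 * k) ∂P + 8 ^ k * ∫ ω, N ω ^ (2 * k) * W ω ^ (2 * k) ∂P := by
        rw [integral_add i1 i2, integral_const_mul, integral_const_mul]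
    _ ≤ 16 ^ k * (8320 * q * t ^ 2) ^ k + 8 ^ k * ((130 * t ^ 2) ^ k * (2080 * q) ^ k) := by
        gcongr
    _ = (16 * (8320 * q * t ^ 2)) ^ k + (8 * (130 * t ^ 2 * (2080 * q))) ^ k := by
        simp only [mul_pow]
    _ ≤ (16 * (8320 * q * t ^ 2) + 8 * (130 * t ^ 2 * (2080 * q))) ^ k :=
        pow_add_pow_le (by positivity) (by positivity) (by omega)
    -- `16 * 8320 + 8 * 130 * 2080 = 2296320`.
    _ ≤ _ := by
        refine pow_le_pow_left₀ (by positivity) ?_ _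
        nlinarith [mul_nonneg hq (sq_nonneg t)]

/-- The increments of `x ↦ ‖∑ x_j Y_j‖ - ‖x‖` have moments controlled by `‖x - y‖`. -/
theorem integral_deviation_sub_pow_le (h : UnitVectorModel P Y σ β) (r : ℕ)
    (x y : EuclideanSpace ℝ ι) :
    ∫ ω, ((‖linComb Y x ω‖ - ‖x‖) - (‖linComb Y y ω‖ - ‖y‖)) ^ (2 * 2 ^ r) ∂P
      ≤ (40000000 * scale σ β (2 * 2 ^ r) * ‖x - y‖ ^ 2) ^ (2 ^ r) := by
  have hk1 : 1 ≤ 2 ^ r := Nat.one_le_two_pow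
  have hqk := h.scale_nonneg (2 ^ r)
  have hqq : scale σ β (2 ^ r) ≤ scale σ β (2 * 2 ^ r) := h.scale_mono (by omega)
  have hq := h.scale_nonneg (2 * 2 ^ r)
  have hnorm : ∀ z : EuclideanSpace ℝ ι, z ≠ 0 → ‖‖z‖⁻¹ • z‖ = 1 := fun z hz => by
    rw [norm_smul, norm_inv, norm_norm, inv_mul_cancel₀ (norm_ne_zero_iff.2 hz)]
  have hdev : ∀ (z : EuclideanSpace ℝ ι) (ω : Ω), z ≠ 0 →
      ‖linComb Y z ω‖ = ‖z‖ * ‖linComb Y (‖z‖⁻¹ • z) ω‖ := fun z ω hz => by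
    rw [linComb_smul, norm_smul, norm_inv, norm_norm, mul_inv_cancel_left₀ (norm_ne_zero_iff.2 hz)]
  have hsingle : ∀ z : EuclideanSpace ℝ ι,
      ∫ ω, (‖linComb Y z ω‖ - ‖z‖) ^ (2 * 2 ^ r) ∂P
        ≤ (40000000 * scale σ β (2 * 2 ^ r) * ‖z‖ ^ 2) ^ (2 ^ r) := fun z => by
    rcases eq_or_ne z 0 with rfl | hz
    · simp [linComb]
    have h1 := h.integral_norm_sub_one_pow_le r (hnorm z hz)
    have e : ∀ ω, (‖linComb Y z ω‖ - ‖z‖) ^ (2 * 2 ^ r)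
        = (‖z‖ ^ 2) ^ 2 ^ r * (‖linComb Y (‖z‖⁻¹ • z) ω‖ - 1) ^ (2 * 2 ^ r) := fun ω => by
      rw [hdev z ω hz, ← pow_mul, ← mul_pow]; ring
    simp only [e]
    rw [integral_const_mul]
    refine (mul_le_mul_of_nonneg_left h1 (by positivity)).trans ?_
    rw [← mul_pow]
    refine pow_le_pow_left₀ (by positivity) ?_ _
    rw [mul_comm]
    gcongr
    norm_num
  rcases eq_or_ne x 0 with rfl | hx
  · have := hsingle y
    have e : ∀ ω, (‖linComb Y (0 : EuclideanSpace ℝ ι) ω‖ - ‖(0 : EuclideanSpace ℝ ι)‖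
        - (‖linComb Y y ω‖ - ‖y‖)) ^ (2 * 2 ^ r) = (‖linComb Y y ω‖ - ‖y‖) ^ (2 * 2 ^ r) := fun ω => by
      rw [← (even_two_mul (2 ^ r)).neg_pow]
      simp [linComb]
    simpa only [e, zero_sub, norm_neg] using this
  rcases eq_or_ne y 0 with rfl | hy
  · simpa [linComb] using hsingle x
  have h1 := h.integral_norm_sub_one_pow_le r (hnorm x hx)
  have h2 := h.integral_norm_sub_norm_pow_le_of_unit r (hnorm x hx) (hnorm y hy)
  have h3 := norm_mul_norm_normalize_sub_le hx hy
  have h4 := abs_norm_sub_norm_le x y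
  set k := 2 ^ r
  set q := scale σ β (2 * k)
  set t := ‖x - y‖
  have ht : 0 ≤ t := norm_nonneg _
  set x' := ‖x‖⁻¹ • x
  set y' := ‖y‖⁻¹ • y
  have hMx := (h.memLp_linComb x').norm
  have hMy := (h.memLp_linComb y').norm
  have i1 : Integrable (fun ω => (‖linComb Y x' ω‖ - 1) ^ (2 * k)) P :=
    ((hMx.sub (memLp_const 1)).top_pow _).integrable le_top
  have i2 : Integrable (fun ω => (‖linComb Y x' ω‖ - ‖linComb Y y' ω‖) ^ (2 * k)) P :=
    ((hMx.sub hMy).top_pow _).integrable le_top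
  have hpt : ∀ ω, ((‖linComb Y x ω‖ - ‖x‖) - (‖linComb Y y ω‖ - ‖y‖)) ^ (2 * k)
      ≤ 4 ^ k * ((t ^ 2) ^ k * (‖linComb Y x' ω‖ - 1) ^ (2 * k)
        + (‖y‖ ^ 2) ^ k * (‖linComb Y x' ω‖ - ‖linComb Y y' ω‖) ^ (2 * k)) := fun ω => by
    -- Polar splitting: a radial increment times the deviation of a unit vector, plus an increment
    -- between unit vectors.
    have e : (‖linComb Y x ω‖ - ‖x‖) - (‖linComb Y y ω‖ - ‖y‖)
        = (‖x‖ - ‖y‖) * (‖linComb Y x' ω‖ - 1)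
          + ‖y‖ * (‖linComb Y x' ω‖ - ‖linComb Y y' ω‖) := by
      rw [hdev x ω hx, hdev y ω hy]; ring
    rw [e]
    refine (add_pow_two_mul_le _ _ _).trans ?_
    rw [mul_pow, mul_pow, ← pow_mul ‖y‖, ← pow_mul t]
    have hev := (even_two_mul k).pow_nonneg (‖linComb Y x' ω‖ - 1)
    have h5 : (‖x‖ - ‖y‖) ^ (2 * k) ≤ t ^ (2 * k) := by
      rw [← (even_two_mul k).pow_abs]
      exact pow_le_pow_left₀ (abs_nonneg _) h4 _
    gcongr
  calc ∫ ω, ((‖linComb Y x ω‖ - ‖x‖) - (‖linComb Y y ω‖ - ‖y‖)) ^ (2 * k) ∂P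
      ≤ ∫ ω, 4 ^ k * ((t ^ 2) ^ k * (‖linComb Y x' ω‖ - 1) ^ (2 * k)
        + (‖y‖ ^ 2) ^ k * (‖linComb Y x' ω‖ - ‖linComb Y y' ω‖) ^ (2 * k)) ∂P := by
        refine integral_mono ?_ (((i1.const_mul _).add (i2.const_mul _)).const_mul _) hpt
        exact (((((h.memLp_linComb x).norm.sub (memLp_const _)).sub
          ((h.memLp_linComb y).norm.sub (memLp_const _)))).top_pow _).integrable le_top
    _ = 4 ^ k * ((t ^ 2) ^ k * (∫ ω, (‖linComb Y x' ω‖ - 1) ^ (2 * k) ∂P)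
        + (‖y‖ ^ 2) ^ k * ∫ ω, (‖linComb Y x' ω‖ - ‖linComb Y y' ω‖) ^ (2 * k) ∂P) := by
        rw [integral_const_mul, integral_add (i1.const_mul _) (i2.const_mul _),
          integral_const_mul, integral_const_mul]
    _ ≤ 4 ^ k * ((t ^ 2) ^ k * (2080 * q) ^ k
        + (‖y‖ ^ 2) ^ k * (2400000 * q * ‖x' - y'‖ ^ 2) ^ k) := by
        gcongr
        exact h1.trans (by gcongr)
    _ = 4 ^ k * ((2080 * q * t ^ 2) ^ k + (2400000 * q * (‖y‖ * ‖x' - y'‖) ^ 2) ^ k) := by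
        simp only [← mul_pow]; ring
    _ ≤ 4 ^ k * ((2080 * q * t ^ 2) ^ k + (2400000 * q * (2 * t) ^ 2) ^ k) := by
        gcongr
    _ ≤ 4 ^ k * (2080 * q * t ^ 2 + 2400000 * q * (2 * t) ^ 2) ^ k := by
        gcongr
        exact pow_add_pow_le (by positivity) (by positivity) (by omega)
    _ = (4 * (2080 * q * t ^ 2 + 2400000 * q * (2 * t) ^ 2)) ^ k := by rw [← mul_pow]
    _ ≤ _ := by
        refine pow_le_pow_left₀ (by positivity) ?_ _
        nlinarith [mul_nonneg hq (sq_nonneg t)]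

end UnitVectorModel

end

/-! ### From `ψ_α` norms to even moments -/

section

variable {Ω : Type*} [MeasurableSpace Ω] {P : Measure Ω}

theorem Real.rpow_le_rpow_self_mul_exp {y p : ℝ} (hy : 0 ≤ y) (hp : 0 < p) :
    y ^ p ≤ p ^ p * Real.exp y := by
  have h1 : y / p ≤ Real.exp (y / p) := by linarith [Real.add_one_le_exp (y / p)]
  calc y ^ p = (p * (y / p)) ^ p := by rw [mul_div_cancel₀ _ hp.ne']
    _ = p ^ p * (y / p) ^ p := Real.mul_rpow hp.le (by positivity)
    _ ≤ p ^ p * Real.exp (y / p) ^ p := by gcongr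
    _ = p ^ p * Real.exp y := by rw [← Real.exp_mul, div_mul_cancel₀ _ hp.ne']

/-- Uses `y^p ≤ p^p e^y` with `y = |ξ/t|^α` and `p = 2l/α`. -/
theorem lintegral_pow_le_of_exp_le {α : ℝ} (hα : 0 < α) {ξ : Ω → ℝ} {t : ℝ} (ht : 0 < t)
    (h : ∫⁻ ω, ENNReal.ofReal (Real.exp (|ξ ω / t| ^ α)) ∂P ≤ 2) {l : ℕ} (hl : 1 ≤ l) :
    ∫⁻ ω, ENNReal.ofReal (ξ ω ^ (2 * l)) ∂P
      ≤ ENNReal.ofReal (2 * (t ^ 2 * (2 * l / α) ^ (2 / α)) ^ l) := by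
  have hl0 : (0 : ℝ) < l := by exact_mod_cast hl
  have hp : 0 < 2 * l / α := by positivity
  have hpp : (2 * l / α) ^ (2 * l / α) = ((2 * l / α) ^ (2 / α)) ^ l := by
    rw [← Real.rpow_mul_natCast hp.le]; congr 1; ring
  have hpt : ∀ ω, ξ ω ^ (2 * l)
      ≤ (t ^ 2 * (2 * l / α) ^ (2 / α)) ^ l * Real.exp (|ξ ω / t| ^ α) := fun ω => by
    have h1 := Real.rpow_le_rpow_self_mul_exp (y := |ξ ω / t| ^ α) (by positivity) hp
    rw [← Real.rpow_mul (abs_nonneg _), mul_div_cancel₀ _ hα.ne', hpp,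
      show (2 * l : ℝ) = ((2 * l : ℕ) : ℝ) by push_cast; ring, Real.rpow_natCast,
      (even_two_mul l).pow_abs] at h1
    calc ξ ω ^ (2 * l) = (t ^ 2) ^ l * (ξ ω / t) ^ (2 * l) := by
          rw [← pow_mul, ← mul_pow, mul_div_cancel₀ _ ht.ne']
      _ ≤ (t ^ 2) ^ l * (((↑(2 * l) / α) ^ (2 / α)) ^ l * Real.exp (|ξ ω / t| ^ α)) := by gcongr
      _ = _ := by push_cast; rw [mul_pow]; ring
  calc ∫⁻ ω, ENNReal.ofReal (ξ ω ^ (2 * l)) ∂P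
      ≤ ∫⁻ ω, ENNReal.ofReal ((t ^ 2 * (2 * l / α) ^ (2 / α)) ^ l)
          * ENNReal.ofReal (Real.exp (|ξ ω / t| ^ α)) ∂P := by
        refine lintegral_mono fun ω => ?_
        rw [← ENNReal.ofReal_mul (by positivity)]
        exact ENNReal.ofReal_le_ofReal (hpt ω)
    _ = ENNReal.ofReal ((t ^ 2 * (2 * l / α) ^ (2 / α)) ^ l)
          * ∫⁻ ω, ENNReal.ofReal (Real.exp (|ξ ω / t| ^ α)) ∂P :=
        lintegral_const_mul' _ _ ENNReal.ofReal_ne_top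
    _ ≤ ENNReal.ofReal ((t ^ 2 * (2 * l / α) ^ (2 / α)) ^ l) * 2 := by gcongr
    _ = _ := by
        rw [mul_comm, ENNReal.ofReal_mul zero_le_two, ENNReal.ofReal_ofNat]

theorem integral_pow_le_of_psiNorm_le {α : ℝ} (hα : 0 < α) {ξ : Ω → ℝ} (hξ : Measurable ξ)
    {K : ℝ≥0} (h : psiNorm P α ξ ≤ K) {l : ℕ} (hl : 1 ≤ l) :
    ∫ ω, ξ ω ^ (2 * l) ∂P ≤ 2 * ((K : ℝ) ^ 2 * (2 * l / α) ^ (2 / α)) ^ l := by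
  -- Attainment of the infimum is avoided: any `s > K` has an admissible `t < s`, and then `s`
  -- decreases to `K`.
  have key : ∀ s : ℝ, K < s →
      ∫ ω, ξ ω ^ (2 * l) ∂P ≤ 2 * (s ^ 2 * (2 * l / α) ^ (2 / α)) ^ l := fun s hs => by
    have h1 : psiNorm P α ξ < ENNReal.ofReal s := by
      refine h.trans_lt ?_
      rw [← ENNReal.ofReal_coe_nnreal]
      exact (ENNReal.ofReal_lt_ofReal_iff (K.2.trans_lt hs)).2 hs
    unfold psiNorm at h1
    simp only [iInf_lt_iff] at h1
    obtain ⟨t, ht, hexp, hts⟩ := h1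
    have hts' : t < s := by
      rw [ENNReal.ofReal_lt_ofReal_iff (K.2.trans_lt hs)] at hts; exact hts
    rw [integral_eq_lintegral_of_nonneg_ae (ae_of_all _ fun ω => (even_two_mul l).pow_nonneg _)
      (hξ.pow_const _).aestronglyMeasurable]
    have h2 := lintegral_pow_le_of_exp_le hα ht hexp hl
    refine (ENNReal.toReal_le_of_le_ofReal (by positivity) h2).trans ?_
    gcongr
  have ht : Filter.Tendsto (fun n : ℕ => 2 * (((K : ℝ) + 1 / ((n : ℝ) + 1)) ^ 2
      * (2 * l / α) ^ (2 / α)) ^ l) Filter.atTop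
      (nhds (2 * (((K : ℝ) + 0) ^ 2 * (2 * l / α) ^ (2 / α)) ^ l)) :=
    ((((tendsto_one_div_add_atTop_nhds_zero_nat.const_add _).pow 2).mul_const _).pow l).const_mul 2
  rw [add_zero] at ht
  refine ge_of_tendsto' ht fun n => key _ ?_
  have : (0 : ℝ) < 1 / ((n : ℝ) + 1) := by positivity
  linarith

theorem integral_inner_pow_le_of_psiNormVec_le {α : ℝ} (hα : 0 < α) {m : ℕ}
    {X : Ω → EuclideanSpace ℝ (Fin m)} (hX : Measurable X) {K : ℝ≥0}
    (h : psiNormVec P α X ≤ K) (w : EuclideanSpace ℝ (Fin m)) {l : ℕ} (hl : 1 ≤ l) :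
    ∫ ω, inner ℝ (X ω) w ^ (2 * l) ∂P
      ≤ (2 * (K : ℝ) ^ 2 * (2 / α) ^ (2 / α) * (l : ℝ) ^ (2 / α) * ‖w‖ ^ 2) ^ l := by
  have hl0 : (0 : ℝ) < l := by exact_mod_cast hl
  rcases eq_or_ne w 0 with rfl | hw
  · simp [show l ≠ 0 by omega]
  have hw' : ‖w‖ ≠ 0 := norm_ne_zero_iff.2 hw
  have h1 : psiNorm P α (fun ω => inner ℝ (X ω) (‖w‖⁻¹ • w)) ≤ K := by
    refine le_trans ?_ h
    unfold psiNormVec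
    refine le_iSup₂ (f := fun (x : EuclideanSpace ℝ (Fin m))
      (_ : x ∈ Metric.sphere (0 : EuclideanSpace ℝ (Fin m)) 1) =>
        psiNorm P α (fun ω => inner ℝ (X ω) x)) (‖w‖⁻¹ • w) ?_
    rw [mem_sphere_zero_iff_norm, norm_smul, norm_inv, norm_norm, inv_mul_cancel₀ hw']
  have h2 := integral_pow_le_of_psiNorm_le hα (hX.inner measurable_const) h1 hl
  have e : ∀ ω, inner ℝ (X ω) w ^ (2 * l)
      = (‖w‖ ^ 2) ^ l * inner ℝ (X ω) (‖w‖⁻¹ • w) ^ (2 * l) := fun ω => by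
    rw [real_inner_smul_right, ← pow_mul, ← mul_pow, mul_inv_cancel_left₀ hw']
  simp only [e]
  rw [integral_const_mul]
  calc (‖w‖ ^ 2) ^ l * ∫ ω, inner ℝ (X ω) (‖w‖⁻¹ • w) ^ (2 * l) ∂P
      ≤ (‖w‖ ^ 2) ^ l * (2 ^ l * ((K : ℝ) ^ 2 * (2 * l / α) ^ (2 / α)) ^ l) := by
        gcongr
        refine h2.trans ?_
        gcongr
        exact le_self_pow₀ one_le_two (by omega)
    _ = _ := by
        rw [← mul_pow, ← mul_pow, show 2 * (l : ℝ) / α = 2 / α * l by ring,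
          Real.mul_rpow (by positivity) hl0.le]
        ring

end

/-! ### Admissible partitions and generic chaining -/

section

theorem partOf_zero_eq_univ {X : Type*} {S : ℕ → Setoid X} (hS : IsAdmissible S) (t : X) :
    partOf (S 0) t = Set.univ := by
  obtain ⟨A, hA⟩ := Set.encard_eq_one.1 hS.card_zero
  have h : ∀ x, {z | S 0 z x} = A := fun x => by
    have := Setoid.mem_classes (S 0) x
    rw [hA] at this
    exact this
  ext x
  simp only [Set.mem_univ, iff_true]
  have hx : x ∈ {z | S 0 z x} := (S 0).refl x
  rw [h x, ← h t] at hx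
  exact hx

/-- The factor `2` leaves room below a positive infimum. If the infimum is zero, the single part at
level `0` forces diameter zero, and any admissible sequence works. -/
theorem exists_admissible_le_two_mul_talagrandGamma {α : ℝ} {X : Type*}
    [PseudoEMetricSpace X] (h : talagrandGamma α X ≠ ⊤) :
    ∃ S : ℕ → Setoid X, IsAdmissible S ∧ ∀ t : X,
      ∑' k : ℕ, (2 : ℝ≥0∞) ^ ((k : ℝ) / α) * Metric.ediam (partOf (S k) t)
        ≤ 2 * talagrandGamma α X := by
  have hex : ∀ c, talagrandGamma α X < c → ∃ S : ℕ → Setoid X, IsAdmissible S ∧ ∀ t : X,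
      ∑' k : ℕ, (2 : ℝ≥0∞) ^ ((k : ℝ) / α) * Metric.ediam (partOf (S k) t) ≤ c := fun c hc => by
    unfold talagrandGamma at hc
    simp only [iInf_lt_iff] at hc
    obtain ⟨S, hS, hlt⟩ := hc
    exact ⟨S, hS, fun t => (le_iSup _ t).trans hlt.le⟩
  rcases eq_or_ne (talagrandGamma α X) 0 with h0 | h0
  · have hdiam : Metric.ediam (Set.univ : Set X) ≤ 0 := by
      refine le_of_forall_gt fun ε hε => ?_
      obtain ⟨δ, hδ0, hδε⟩ := exists_between hε
      obtain ⟨S, hS, hle⟩ := hex δ (by rwa [h0])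
      rcases isEmpty_or_nonempty X with hX | ⟨⟨t⟩⟩
      · rw [Set.univ_eq_empty_iff.2 hX, Metric.ediam_empty]; exact hε
      · refine lt_of_le_of_lt ?_ hδε
        refine le_trans ?_ ((ENNReal.le_tsum 0).trans (hle t))
        rw [partOf_zero_eq_univ hS]; simp
    obtain ⟨S, hS, -⟩ := hex ⊤ h.lt_top
    refine ⟨S, hS, fun t => ?_⟩
    have : ∀ k, Metric.ediam (partOf (S k) t) = 0 := fun k =>
      le_antisymm ((Metric.ediam_mono (Set.subset_univ _)).trans hdiam) bot_le
    simp [this]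
  · refine hex _ ?_
    rw [two_mul]
    exact ENNReal.lt_add_right h h0

theorem finite_quotient_of_isAdmissible {X : Type*} {S : ℕ → Setoid X} (hS : IsAdmissible S)
    (k : ℕ) : Finite (Quotient (S k)) ∧ Nat.card (Quotient (S k)) ≤ 2 ^ 2 ^ k := by
  have hle : (S k).classes.encard ≤ ((2 ^ 2 ^ k : ℕ) : ℕ∞) := by
    rcases Nat.eq_zero_or_pos k with rfl | hk
    · rw [hS.card_zero]; norm_num
    · simpa using hS.card_le k hk
  have hfin : (S k).classes.Finite := Set.finite_of_encard_le_coe hle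
  have := hfin.to_subtype
  have e := (S k).quotientEquivClasses
  refine ⟨Finite.of_equiv _ e.symm, ?_⟩
  rw [Nat.card_congr e, Nat.card_coe_set_eq]
  rw [← hfin.cast_ncard_eq] at hle
  exact_mod_cast hle

theorem ENNReal.tsum_quotient_le {X : Type*} {S : ℕ → Setoid X} (hS : IsAdmissible S) (k : ℕ)
    {f : Quotient (S k) → ℝ≥0∞} {c : ℝ≥0∞} (hf : ∀ q, f q ≤ c) :
    ∑' q, f q ≤ 2 ^ 2 ^ k * c := by
  obtain ⟨hfin, hcard⟩ := finite_quotient_of_isAdmissible hS k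
  have := Fintype.ofFinite (Quotient (S k))
  rw [tsum_fintype]
  refine (Finset.sum_le_sum fun q _ => hf q).trans ?_
  rw [Finset.sum_const, Finset.card_univ, ← Nat.card_eq_fintype_card, nsmul_eq_mul]
  gcongr
  exact_mod_cast hcard

theorem two_pow_mul_exp_le (k n : ℕ) (c : ℝ) (h : (2 : ℝ) ^ n ≤ c) :
    (2 : ℝ≥0∞) ^ 2 ^ n * ENNReal.ofReal (Real.exp (-(c + k)))
      ≤ ENNReal.ofReal (Real.exp (-k)) := by
  have h2 : (2 : ℝ≥0∞) ^ 2 ^ n ≤ ENNReal.ofReal (Real.exp (2 ^ n)) := by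
    rw [← ENNReal.ofReal_ofNat 2, ← ENNReal.ofReal_pow zero_le_two]
    refine ENNReal.ofReal_le_ofReal ?_
    have h3 : (2 : ℝ) ≤ Real.exp 1 := by linarith [Real.add_one_le_exp (1 : ℝ)]
    calc (2 : ℝ) ^ 2 ^ n ≤ Real.exp 1 ^ 2 ^ n := by gcongr
      _ = Real.exp (2 ^ n) := by rw [← Real.exp_nat_mul]; simp
  calc (2 : ℝ≥0∞) ^ 2 ^ n * ENNReal.ofReal (Real.exp (-(c + k)))
      ≤ ENNReal.ofReal (Real.exp (2 ^ n)) * ENNReal.ofReal (Real.exp (-(c + k))) := by gcongr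
    _ = ENNReal.ofReal (Real.exp (2 ^ n + -(c + k))) := by
        rw [← ENNReal.ofReal_mul (Real.exp_pos _).le, Real.exp_add]
    _ ≤ _ := by
        refine ENNReal.ofReal_le_ofReal (Real.exp_le_exp.2 ?_)
        linarith

theorem tsum_ofReal_exp_le (a : ℝ) :
    ∑' j : ℕ, ENNReal.ofReal (Real.exp (-(a + (j + 1)))) ≤ ENNReal.ofReal (Real.exp (-a)) := by
  have h1 : ∀ j : ℕ, ENNReal.ofReal (Real.exp (-(a + (j + 1))))
      ≤ ENNReal.ofReal (Real.exp (-a)) * 2⁻¹ ^ (j + 1) := fun j => by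
    rw [neg_add, Real.exp_add, ENNReal.ofReal_mul (Real.exp_pos _).le]
    gcongr
    have h3 : (2 : ℝ) ≤ Real.exp 1 := by linarith [Real.add_one_le_exp (1 : ℝ)]
    have h4 : Real.exp (-((j : ℝ) + 1)) ≤ 2⁻¹ ^ (j + 1) := by
      rw [Real.exp_neg, inv_pow]
      gcongr
      calc (2 : ℝ) ^ (j + 1) ≤ Real.exp 1 ^ (j + 1) := by gcongr
        _ = _ := by rw [← Real.exp_nat_mul]; simp
    refine (ENNReal.ofReal_le_ofReal h4).trans_eq ?_
    rw [ENNReal.ofReal_pow (by norm_num), ENNReal.ofReal_inv_of_pos two_pos, ENNReal.ofReal_ofNat]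
  refine (ENNReal.tsum_le_tsum h1).trans_eq ?_
  rw [ENNReal.tsum_mul_left, ENNReal.tsum_geometric_add_one, ENNReal.one_sub_inv_two, inv_inv,
    ENNReal.inv_mul_cancel two_ne_zero ENNReal.ofNat_ne_top, mul_one]

variable {Ω : Type*} [MeasurableSpace Ω] {P : Measure Ω}

/-- A high power of a normalized variable `Z / s`, dominating its excess over `1`. -/
noncomputable def normalizedPow (Z : Ω → ℝ) (s : ℝ≥0∞) (r : ℕ) (ω : Ω) : ℝ≥0∞ := (‖Z ω‖ₑ / s) ^ (2 * 2 ^ r)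

theorem measurable_normalizedPow {Z : Ω → ℝ} (hZ : Measurable Z) (s : ℝ≥0∞) (r : ℕ) :
    Measurable (normalizedPow Z s r) := (hZ.enorm.div_const _).pow_const _

theorem enorm_le_mul_one_add_normalizedPow {Z : Ω → ℝ} {s : ℝ≥0∞} {ω : Ω} (hs : s ≠ ⊤)
    (h0 : s = 0 → Z ω = 0) (r : ℕ) : ‖Z ω‖ₑ ≤ s * (1 + normalizedPow Z s r ω) := by
  rcases eq_or_ne s 0 with h | h
  · simp [h0 h]
  · have h1 : ‖Z ω‖ₑ / s ≤ 1 + normalizedPow Z s r ω := by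
      unfold normalizedPow
      rcases le_total (‖Z ω‖ₑ / s) 1 with hle | hle
      · exact hle.trans le_self_add
      · exact (le_self_pow₀ hle (by positivity)).trans le_add_self
    calc ‖Z ω‖ₑ = s * (‖Z ω‖ₑ / s) := (ENNReal.mul_div_cancel h hs).symm
      _ ≤ _ := by gcongr

/-- Normalizing by an extra `e^2` gains `e^(-2p)` at order `p = 2 * 2^r`, enough to beat the
`2^(2^(r+1))` parts of the next level. -/
theorem lintegral_normalizedPow_le {Z : Ω → ℝ} (hZ : Measurable Z) {τ : ℝ≥0∞} (hτ : τ ≠ ⊤)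
    {r : ℕ} (h : ∫⁻ ω, ‖Z ω‖ₑ ^ (2 * 2 ^ r) ∂P ≤ τ ^ (2 * 2 ^ r)) :
    ∫⁻ ω, normalizedPow Z (ENNReal.ofReal (Real.exp 2) * τ) r ω ∂P
      ≤ ENNReal.ofReal (Real.exp (-(4 * 2 ^ r))) := by
  have hp : 2 * 2 ^ r ≠ 0 := by positivity
  set p := 2 * 2 ^ r with hpdef
  rcases eq_or_ne τ 0 with rfl | h0
  · rw [zero_pow hp, nonpos_iff_eq_zero, lintegral_eq_zero_iff (hZ.enorm.pow_const _)] at h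
    rw [lintegral_eq_zero_of_ae_eq_zero]
    · exact bot_le
    · filter_upwards [h] with ω hω
      have : ‖Z ω‖ₑ = 0 := by simpa [hp] using hω
      simp [normalizedPow, this]
  · have he0 : ENNReal.ofReal (Real.exp 2) ≠ 0 := by
      rw [Ne, ENNReal.ofReal_eq_zero, not_le]; exact Real.exp_pos 2
    set e2 := ENNReal.ofReal (Real.exp 2) with he2
    calc ∫⁻ ω, normalizedPow Z (e2 * τ) r ω ∂P
        = ∫⁻ ω, ((e2 * τ)⁻¹) ^ p * ‖Z ω‖ₑ ^ p ∂P := by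
          refine lintegral_congr fun ω => ?_
          rw [normalizedPow, ENNReal.div_eq_inv_mul, mul_pow]
      _ = ((e2 * τ)⁻¹) ^ p * ∫⁻ ω, ‖Z ω‖ₑ ^ p ∂P := lintegral_const_mul _ (hZ.enorm.pow_const _)
      _ ≤ ((e2 * τ)⁻¹) ^ p * τ ^ p := by gcongr
      _ = (e2⁻¹) ^ p := by
          rw [← mul_pow, ENNReal.mul_inv (Or.inl he0) (Or.inr h0), mul_assoc,
            ENNReal.inv_mul_cancel h0 hτ, mul_one]
      _ = ENNReal.ofReal (Real.exp (-(4 * 2 ^ r))) := by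
          rw [he2, ← ENNReal.ofReal_inv_of_pos (Real.exp_pos 2), ← Real.exp_neg,
            ← ENNReal.ofReal_pow (Real.exp_pos _).le, ← Real.exp_nat_mul, hpdef]
          congr 2; push_cast; ring
      _ ≤ _ := le_rfl

variable {F : Type*} [NormedAddCommGroup F]

/-- Generic chaining above level `k₀` for a process whose increments have `ψ_α`-type moments. -/
theorem exists_chaining_bound {α : ℝ} (hα : 0 < α) {X : F → Ω → ℝ} (hXm : ∀ x, Measurable (X x))
    (hX0 : ∀ ω, X 0 ω = 0) (hXc : ∀ ω, Continuous fun x => X x ω) {B : ℝ≥0} (hB : B ≠ 0)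
    (hmom : ∀ (r : ℕ) x y, ∫⁻ ω, ‖X x ω - X y ω‖ₑ ^ (2 * 2 ^ r) ∂P
      ≤ (B * (2 : ℝ≥0∞) ^ ((r : ℝ) / α) * ‖x - y‖ₑ) ^ (2 * 2 ^ r))
    {T : Set F} {S : ℕ → Setoid T} (hS : IsAdmissible S) {γ : ℝ≥0∞} (hγ : γ ≠ ⊤)
    (hle : ∀ t : T, ∑' k : ℕ, (2 : ℝ≥0∞) ^ ((k : ℝ) / α) * Metric.ediam (partOf (S k) t) ≤ γ)
    {R : ℝ≥0∞} (hR : ∀ t ∈ T, ‖t‖ₑ ≤ R) (k₀ : ℕ) :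
    ∃ Φ : Ω → ℝ≥0∞, Measurable Φ ∧
      ∫⁻ ω, Φ ω ∂P ≤ 2 * ENNReal.ofReal (Real.exp (-2 ^ k₀)) ∧
      ∀ ω, ∀ t ∈ T, ‖X t ω‖ₑ ≤ ENNReal.ofReal (Real.exp 2) * B * (1 + Φ ω)
        * ((2 : ℝ≥0∞) ^ ((k₀ : ℝ) / α) * R + γ) := by
  have hcount : ∀ k, Countable (Quotient (S k)) := fun k => by
    have := (finite_quotient_of_isAdmissible hS k).1
    infer_instance
  set e2 := ENNReal.ofReal (Real.exp 2) with he2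
  have he0 : e2 ≠ 0 := by
    rw [he2, Ne, ENNReal.ofReal_eq_zero, not_le]; exact Real.exp_pos 2
  have h2t : ∀ k : ℕ, (2 : ℝ≥0∞) ^ ((k : ℝ) / α) ≠ ⊤ := fun k =>
    ENNReal.rpow_ne_top_of_nonneg (by positivity) ENNReal.ofNat_ne_top
  have h20 : ∀ k : ℕ, (2 : ℝ≥0∞) ^ ((k : ℝ) / α) ≠ 0 := fun k =>
    (ENNReal.rpow_pos two_pos ENNReal.ofNat_ne_top).ne'
  have hB' : (B : ℝ≥0∞) ≠ 0 := by exact_mod_cast hB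
  set τ : ℕ → F → F → ℝ≥0∞ := fun k x y => B * (2 : ℝ≥0∞) ^ ((k : ℝ) / α) * ‖x - y‖ₑ with hτ
  have hτt : ∀ k x y, τ k x y ≠ ⊤ := fun k x y =>
    ENNReal.mul_ne_top (ENNReal.mul_ne_top ENNReal.coe_ne_top (h2t k)) enorm_ne_top
  set φ : ℕ → F → F → Ω → ℝ≥0∞ := fun k x y =>
    normalizedPow (fun ω => X x ω - X y ω) (e2 * τ k x y) k with hφ
  have hφm : ∀ k x y, Measurable (φ k x y) := fun k x y =>
    measurable_normalizedPow ((hXm x).sub (hXm y)) _ _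
  have hφi : ∀ k x y, ∫⁻ ω, φ k x y ω ∂P ≤ ENNReal.ofReal (Real.exp (-(4 * 2 ^ k))) :=
    fun k x y => lintegral_normalizedPow_le ((hXm x).sub (hXm y)) (hτt k x y) (hmom k x y)
  have hφb : ∀ k x y ω, ‖X x ω - X y ω‖ₑ ≤ e2 * τ k x y * (1 + φ k x y ω) := fun k x y ω => by
    refine enorm_le_mul_one_add_normalizedPow (Z := fun ω => X x ω - X y ω)
      (ENNReal.mul_ne_top ENNReal.ofReal_ne_top (hτt k x y)) (fun h => ?_) k
    have : ‖x - y‖ₑ = 0 := (mul_eq_zero.1 ((mul_eq_zero.1 h).resolve_left he0)).resolve_left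
      (mul_ne_zero hB' (h20 k))
    rw [enorm_eq_zero, sub_eq_zero] at this
    simp [this]
  set cen : ∀ k, Quotient (S k) → T := fun k q => q.out with hcen
  -- `Φ₀` collects the links from `0` to level `k₀`, `Φ₁ j` those between levels `k₀ + j` and `k₀ +
  -- j + 1`. The finer part alone indexes a link, since it determines its parent.
  set Φ₀ : Ω → ℝ≥0∞ := fun ω => ∑' q : Quotient (S k₀), φ k₀ (cen k₀ q) 0 ω with hΦ₀
  set Φ₁ : ℕ → Ω → ℝ≥0∞ := fun j ω => ∑' q : Quotient (S (k₀ + j + 1)),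
    φ (k₀ + j) (cen _ q) (cen (k₀ + j) (Quotient.mk _ (cen _ q))) ω with hΦ₁
  have hΦ₀m : Measurable Φ₀ := Measurable.tsum fun q => hφm _ _ _
  have hΦ₁m : ∀ j, Measurable (Φ₁ j) := fun j => Measurable.tsum fun q => hφm _ _ _
  refine ⟨fun ω => Φ₀ ω + ∑' j, Φ₁ j ω, hΦ₀m.add (Measurable.tsum hΦ₁m), ?_, ?_⟩
  · rw [lintegral_add_left hΦ₀m, lintegral_tsum fun j => (hΦ₁m j).aemeasurable, two_mul]
    refine add_le_add ?_ ?_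
    · rw [lintegral_tsum fun q => (hφm _ _ _).aemeasurable]
      refine (ENNReal.tsum_quotient_le hS k₀ fun q => hφi _ _ _).trans ?_
      have h := two_pow_mul_exp_le (2 ^ k₀) k₀ (3 * 2 ^ k₀) (by nlinarith [pow_pos two_pos k₀ (M₀ := ℝ)])
      push_cast at h
      rwa [show (3 * 2 ^ k₀ + 2 ^ k₀ : ℝ) = 4 * 2 ^ k₀ by ring] at h
    · refine (ENNReal.tsum_le_tsum fun j => ?_).trans (tsum_ofReal_exp_le (2 ^ k₀))
      rw [lintegral_tsum fun q => (hφm _ _ _).aemeasurable]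
      refine (ENNReal.tsum_quotient_le hS (k₀ + j + 1) fun q => hφi _ _ _).trans ?_
      -- Half of the exponent `4 * 2^(k₀+j)` pays for the number of parts; the other half dominates
      -- `2^k₀ + (j + 1)`, which is summable in `j`.
      have h := two_pow_mul_exp_le (2 * 2 ^ (k₀ + j)) (k₀ + j + 1) (2 * 2 ^ (k₀ + j))
        (by rw [pow_succ, mul_comm])
      push_cast at h
      rw [show (2 * 2 ^ (k₀ + j) + 2 * 2 ^ (k₀ + j) : ℝ) = 4 * 2 ^ (k₀ + j) by ring] at h
      refine h.trans (ENNReal.ofReal_le_ofReal (Real.exp_le_exp.2 (neg_le_neg ?_)))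
      have h1 : (2 : ℝ) ^ k₀ ≤ 2 ^ (k₀ + j) := pow_le_pow_right₀ one_le_two (by omega)
      have h2 : (j : ℝ) + 1 ≤ 2 ^ (k₀ + j) := by
        have h3 : j + 1 ≤ 2 ^ (k₀ + j) :=
          (Nat.lt_two_pow_self (n := j)).trans_le (Nat.pow_le_pow_right two_pos (by omega))
        exact_mod_cast h3
      linarith
  · intro ω t ht
    set Ψ := 1 + (Φ₀ ω + ∑' j, Φ₁ j ω) with hΨ
    set t' : T := ⟨t, ht⟩
    set π : ℕ → T := fun k => cen k (Quotient.mk (S k) t') with hπ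
    have hπpart : ∀ k, π k ∈ partOf (S k) t' := fun k => Quotient.mk_out (s := S k) t'
    have htpart : ∀ k, t' ∈ partOf (S k) t' := fun k => (S k).refl t'
    have hπsucc : ∀ k, π (k + 1) ∈ partOf (S k) t' := fun k => hS.refines k (hπpart (k + 1))
    have hmk : ∀ k, Quotient.mk (S k) (π (k + 1)) = Quotient.mk (S k) t' := fun k =>
      Quotient.sound (hπsucc k)
    have hed : ∀ x y : T, ‖(x : F) - y‖ₑ = edist x y := fun x y => by
      rw [← edist_eq_enorm_sub]; rfl
    have hinit : ‖X (π k₀) ω‖ₑ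
        ≤ e2 * B * Ψ * ((2 : ℝ≥0∞) ^ ((k₀ : ℝ) / α) * R) := by
      have h1 := hφb k₀ (π k₀) 0 ω
      rw [hX0, sub_zero] at h1
      refine h1.trans ?_
      have h2 : φ k₀ (π k₀) 0 ω ≤ Φ₀ ω + ∑' j, Φ₁ j ω :=
        (ENNReal.le_tsum (f := fun q : Quotient (S k₀) => φ k₀ (cen k₀ q) 0 ω)
          (Quotient.mk (S k₀) t')).trans le_self_add
      have h3 : ‖(π k₀ : F)‖ₑ ≤ R := hR _ (π k₀).2
      have h4 : 1 + φ k₀ (π k₀) 0 ω ≤ Ψ := add_le_add_right h2 1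
      calc e2 * τ k₀ (π k₀) 0 * (1 + φ k₀ (π k₀) 0 ω)
          ≤ e2 * (B * (2 : ℝ≥0∞) ^ ((k₀ : ℝ) / α) * R) * Ψ := by
            simp only [hτ, sub_zero]; gcongr
        _ = _ := by ring
    have hstep : ∀ j, ‖X (π (k₀ + j + 1)) ω - X (π (k₀ + j)) ω‖ₑ
        ≤ e2 * B * Ψ * ((2 : ℝ≥0∞) ^ (((k₀ + j : ℕ) : ℝ) / α)
          * Metric.ediam (partOf (S (k₀ + j)) t')) := fun j => by
      have h1 := hφb (k₀ + j) (π (k₀ + j + 1)) (π (k₀ + j)) ω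
      refine h1.trans ?_
      have h2 : φ (k₀ + j) (π (k₀ + j + 1)) (π (k₀ + j)) ω ≤ Φ₀ ω + ∑' j, Φ₁ j ω := by
        refine le_trans ?_ ((ENNReal.le_tsum (f := fun j => Φ₁ j ω) j).trans le_add_self)
        refine le_trans (le_of_eq ?_) (ENNReal.le_tsum (f := fun q : Quotient (S (k₀ + j + 1)) =>
          φ (k₀ + j) (cen _ q) (cen (k₀ + j) (Quotient.mk _ (cen _ q))) ω)
          (Quotient.mk (S (k₀ + j + 1)) t'))
        have := hmk (k₀ + j)
        simp only [hπ] at this ⊢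
        rw [this]
      have h3 : ‖(π (k₀ + j + 1) : F) - π (k₀ + j)‖ₑ
          ≤ Metric.ediam (partOf (S (k₀ + j)) t') := by
        rw [hed]; exact Metric.edist_le_ediam_of_mem (hπsucc _) (hπpart _)
      have h4 : 1 + φ (k₀ + j) (π (k₀ + j + 1)) (π (k₀ + j)) ω ≤ Ψ := add_le_add_right h2 1
      calc e2 * τ (k₀ + j) (π (k₀ + j + 1)) (π (k₀ + j))
            * (1 + φ (k₀ + j) (π (k₀ + j + 1)) (π (k₀ + j)) ω)
          ≤ e2 * (B * (2 : ℝ≥0∞) ^ (((k₀ + j : ℕ) : ℝ) / α)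
            * Metric.ediam (partOf (S (k₀ + j)) t')) * Ψ := by
            simp only [hτ]; gcongr
        _ = _ := by ring
    have hN : ∀ N, ‖X (π (k₀ + N)) ω‖ₑ
        ≤ e2 * B * Ψ * ((2 : ℝ≥0∞) ^ ((k₀ : ℝ) / α) * R)
          + ∑ j ∈ Finset.range N, e2 * B * Ψ * ((2 : ℝ≥0∞) ^ (((k₀ + j : ℕ) : ℝ) / α)
          * Metric.ediam (partOf (S (k₀ + j)) t')) := fun N => by
      induction N with
      | zero => simpa using hinit
      | succ N ih =>
        rw [Finset.sum_range_succ]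
        calc ‖X (π (k₀ + (N + 1))) ω‖ₑ
            = ‖X (π (k₀ + N)) ω + (X (π (k₀ + N + 1)) ω - X (π (k₀ + N)) ω)‖ₑ := by
              rw [add_sub_cancel]; rfl
          _ ≤ ‖X (π (k₀ + N)) ω‖ₑ + ‖X (π (k₀ + N + 1)) ω - X (π (k₀ + N)) ω‖ₑ :=
              enorm_add_le _ _
          _ ≤ _ := (add_le_add ih (hstep N)).trans_eq (add_assoc _ _ _)
    -- The weights are at least `1`, so the finite sum forces the diameters to zero and the path
    -- reaches `t`; continuity then carries the bound to `t` for every `ω`.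
    have hlim : Filter.Tendsto (fun N => ‖X (π (k₀ + N)) ω‖ₑ) Filter.atTop (nhds ‖X t ω‖ₑ) := by
      have h1 : Filter.Tendsto (fun k => (π k : F)) Filter.atTop (nhds t) := by
        rw [tendsto_iff_edist_tendsto_0]
        have h0 := ENNReal.tendsto_atTop_zero_of_tsum_ne_top (ne_top_of_le_ne_top hγ (hle t'))
        refine tendsto_of_tendsto_of_tendsto_of_le_of_le tendsto_const_nhds h0
          (fun _ => bot_le) fun k => ?_
        have h4 : edist (π k : F) t ≤ Metric.ediam (partOf (S k) t') :=
          Metric.edist_le_ediam_of_mem (hπpart k) (htpart k)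
        refine h4.trans (le_mul_of_one_le_left bot_le ?_)
        simpa using ENNReal.rpow_le_rpow_of_exponent_le (one_le_two (α := ℝ≥0∞))
          (by positivity : (0 : ℝ) ≤ (k : ℝ) / α)
      have h2 : Filter.Tendsto (fun N => (π (k₀ + N) : F)) Filter.atTop (nhds t) :=
        h1.comp (Filter.tendsto_atTop_mono (fun N => Nat.le_add_left N k₀) Filter.tendsto_id)
      exact (continuous_enorm.tendsto _).comp (((hXc ω).tendsto t).comp h2)
    refine le_of_tendsto' hlim fun N => (hN N).trans ?_
    rw [mul_add (e2 * B * Ψ), ← Finset.mul_sum]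
    gcongr
    refine le_trans ?_ (hle t')
    have h5 := ENNReal.sum_le_tsum (f := fun k : ℕ => (2 : ℝ≥0∞) ^ ((k : ℝ) / α)
      * Metric.ediam (partOf (S k) t')) ((Finset.range N).map (addLeftEmbedding k₀))
    simpa only [Finset.sum_map, addLeftEmbedding_apply] using h5

end

/-! ### Distortion of the matrix: expectation and tail -/

section

theorem euclMulVec_eq_linComb {m n : ℕ} {Ω : Type*} (A : Ω → Matrix (Fin m) (Fin n) ℝ)
    (x : EuclideanSpace ℝ (Fin n)) (ω : Ω) :
    euclMulVec (A ω) x = linComb (fun j ω => euclCol (A ω) j) x ω := by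
  ext i
  simp [euclMulVec, linComb, euclCol, Matrix.mulVec, dotProduct, mul_comm]

variable {Ω : Type*} [MeasurableSpace Ω] {P : Measure Ω}

theorem unitVectorModel_euclCol {α : ℝ} (hα : 0 < α) (hα2 : α ≤ 2) {m n : ℕ}
    {A : Ω → Matrix (Fin m) (Fin n) ℝ} {K : ℝ≥0} (hA : ∀ i j, Measurable fun ω => A ω i j)
    (hind : iIndepFun (fun (j : Fin n) (ω : Ω) => euclCol (A ω) j) P)
    (hmean : ∀ j, ∫ ω, euclCol (A ω) j ∂P = 0)
    (hnorm : ∀ j, ∀ᵐ ω ∂P, ‖euclCol (A ω) j‖ = 1)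
    (hpsi : ∀ j, psiNormVec P α (fun ω => euclCol (A ω) j) ≤ K) :
    UnitVectorModel P (fun j ω => euclCol (A ω) j)
      (2 * (K : ℝ) ^ 2 * (2 / α) ^ (2 / α)) (2 / α) := by
  have hm : ∀ j, Measurable fun ω => euclCol (A ω) j := fun j =>
    (MeasurableEquiv.toLp 2 (Fin m → ℝ)).measurable.comp (measurable_pi_lambda _ fun i => hA i j)
  exact
    { meas := hm
      indep := hind
      mean := hmean
      norm_eq := hnorm
      nonneg := by positivity
      one_le := by rw [le_div_iff₀ hα]; linarith
      moment := fun j w l hl => integral_inner_pow_le_of_psiNormVec_le hα (hm j) (hpsi j) w hl }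

/-- With `σ = 0` every coordinate vanishes almost surely, against the unit norm. This rules out `K =
0`, so that `K` times an infinite `γ_α` is infinite. -/
theorem UnitVectorModel.sigma_ne_zero [IsProbabilityMeasure P] {m : ℕ} {ι : Type*} [Fintype ι]
    {Y : ι → Ω → EuclideanSpace ℝ (Fin m)} {σ β : ℝ} (h : UnitVectorModel P Y σ β) (j : ι) :
    σ ≠ 0 := by
  rintro rfl
  have h1 : ∀ i : Fin m, ∀ᵐ ω ∂P, Y j ω i = 0 := fun i => by
    have h2 := h.moment j (EuclideanSpace.single i 1) 1 le_rfl
    have h3 : ∀ ω, inner ℝ (Y j ω) (EuclideanSpace.single i (1 : ℝ)) = Y j ω i := fun ω => by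
      simp [EuclideanSpace.inner_single_right]
    simp only [h3, mul_one, zero_mul, pow_one] at h2
    have h4 : Integrable (fun ω => Y j ω i ^ 2) P := by
      simp only [← h3]
      exact (((h.memLp j).top_inner (memLp_const _)).top_pow 2).integrable le_top
    have h5 := (integral_eq_zero_iff_of_nonneg (fun ω => sq_nonneg (Y j ω i)) h4).1
      (le_antisymm h2 (integral_nonneg fun ω => sq_nonneg _))
    filter_upwards [h5] with ω hω
    simpa using hω
  have h6 : ∀ᵐ _ω ∂P, False := by
    filter_upwards [ae_all_iff.2 h1, h.norm_eq j] with ω h7 h8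
    have : Y j ω = 0 := by ext i; simpa using h7 i
    rw [this] at h8
    simp at h8
  simpa using h6.exists

/-- The `α`-dependent factor in the moment bound of the increments. -/
noncomputable def incrementConst (α : ℝ) : ℝ≥0 :=
  Real.toNNReal (Real.sqrt (640000000 * ((2 / α) ^ (2 / α) * 2 ^ (2 / α))))

theorem incrementConst_ne_zero {α : ℝ} (hα : 0 < α) : incrementConst α ≠ 0 := by
  have : 0 < incrementConst α := Real.toNNReal_pos.2 (Real.sqrt_pos.2 (by positivity))
  exact this.ne'

theorem UnitVectorModel.lintegral_deviation_sub_pow_le [IsProbabilityMeasure P] {E : Type*}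
    [NormedAddCommGroup E] [InnerProductSpace ℝ E] [CompleteSpace E]
    [SecondCountableTopology E] [MeasurableSpace E] [BorelSpace E] {ι : Type*} [Fintype ι]
    {Y : ι → Ω → E} {α : ℝ} (hα : 0 < α) {K : ℝ≥0}
    (h : UnitVectorModel P Y (2 * (K : ℝ) ^ 2 * (2 / α) ^ (2 / α)) (2 / α)) (r : ℕ)
    (x y : EuclideanSpace ℝ ι) :
    ∫⁻ ω, ‖(‖linComb Y x ω‖ - ‖x‖) - (‖linComb Y y ω‖ - ‖y‖)‖ₑ ^ (2 * 2 ^ r) ∂P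
      ≤ (((incrementConst α * K : ℝ≥0) : ℝ≥0∞) * (2 : ℝ≥0∞) ^ ((r : ℝ) / α) * ‖x - y‖ₑ)
        ^ (2 * 2 ^ r) := by
  set Z : Ω → ℝ := fun ω => (‖linComb Y x ω‖ - ‖x‖) - (‖linComb Y y ω‖ - ‖y‖) with hZ
  have hMZ : MemLp Z ∞ P := ((h.memLp_linComb x).norm.sub (memLp_const _)).sub
    ((h.memLp_linComb y).norm.sub (memLp_const _))
  have hmom := h.integral_deviation_sub_pow_le r x y
  have e : ∀ ω, ‖Z ω‖ₑ ^ (2 * 2 ^ r) = ENNReal.ofReal (Z ω ^ (2 * 2 ^ r)) := fun ω => by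
    rw [Real.enorm_eq_ofReal_abs, ← ENNReal.ofReal_pow (abs_nonneg _), (even_two_mul _).pow_abs]
  have hB : ((incrementConst α * K : ℝ≥0) : ℝ) ^ 2
      = 640000000 * ((2 / α) ^ (2 / α) * 2 ^ (2 / α)) * (K : ℝ) ^ 2 := by
    rw [NNReal.coe_mul, mul_pow, incrementConst, Real.coe_toNNReal _ (Real.sqrt_nonneg _),
      Real.sq_sqrt (by positivity)]
  -- `640000000 = 40000000 * 8 * 2`, from the increment bound, `scale` and `σ`; the factor `2^(2/α)`
  -- comes from the doubled order.
  have hbound : (40000000 * scale (2 * (K : ℝ) ^ 2 * (2 / α) ^ (2 / α)) (2 / α) (2 * 2 ^ r)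
      * ‖x - y‖ ^ 2) = (((incrementConst α * K : ℝ≥0) : ℝ) * 2 ^ ((r : ℝ) / α) * ‖x - y‖) ^ 2 := by
    rw [mul_pow, mul_pow, hB, scale]
    push_cast
    rw [Real.mul_rpow zero_le_two (by positivity), ← Real.rpow_natCast 2 r, ← Real.rpow_mul
      zero_le_two, ← Real.rpow_mul_natCast zero_le_two (r / α) 2,
      show (r : ℝ) / α * (2 : ℕ) = r * (2 / α) by push_cast; ring]
    ring
  rw [lintegral_congr e, ← ofReal_integral_eq_lintegral_ofReal ((hMZ.top_pow _).integrable le_top)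
    (ae_of_all _ fun ω => (even_two_mul _).pow_nonneg _)]
  rw [hbound, ← pow_mul] at hmom
  refine (ENNReal.ofReal_le_ofReal hmom).trans_eq ?_
  rw [ENNReal.ofReal_pow (by positivity), ENNReal.ofReal_mul (by positivity),
    ENNReal.ofReal_mul (by positivity), ENNReal.ofReal_coe_nnreal, ofReal_norm,
    ← ENNReal.ofReal_rpow_of_pos two_pos, ENNReal.ofReal_ofNat]

/-- Chaining bound for the distortion of a matrix with independent unit columns. -/
theorem exists_distortion_le [IsProbabilityMeasure P] {α : ℝ} (hα : 0 < α) {m n : ℕ}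
    {A : Ω → Matrix (Fin m) (Fin n) ℝ} {K : ℝ≥0} (hK : K ≠ 0)
    (h : UnitVectorModel P (fun j ω => euclCol (A ω) j)
      (2 * (K : ℝ) ^ 2 * (2 / α) ^ (2 / α)) (2 / α))
    {T : Set (EuclideanSpace ℝ (Fin n))} (hT : talagrandGamma α T ≠ ⊤) (k₀ : ℕ) :
    ∃ Φ : Ω → ℝ≥0∞, Measurable Φ ∧
      ∫⁻ ω, Φ ω ∂P ≤ 2 * ENNReal.ofReal (Real.exp (-2 ^ k₀)) ∧
      ∀ ω, distortion (A ω) T ≤ ENNReal.ofReal (Real.exp 2) * (incrementConst α * K : ℝ≥0)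
        * (1 + Φ ω) * ((2 : ℝ≥0∞) ^ ((k₀ : ℝ) / α) * rad T + 2 * talagrandGamma α T) := by
  obtain ⟨S, hS, hle⟩ := exists_admissible_le_two_mul_talagrandGamma hT
  set Y : Fin n → Ω → EuclideanSpace ℝ (Fin m) := fun j ω => euclCol (A ω) j with hY
  obtain ⟨Φ, hΦm, hΦi, hΦ⟩ := exists_chaining_bound (P := P) hα
    (X := fun x ω => ‖linComb Y x ω‖ - ‖x‖)
    (fun x => (h.measurable_linComb x).norm.sub_const _)
    (fun ω => by simp [linComb])
    (fun ω => by unfold linComb; fun_prop)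
    (mul_ne_zero (incrementConst_ne_zero hα) hK)
    (h.lintegral_deviation_sub_pow_le hα) hS (ENNReal.mul_ne_top ENNReal.ofNat_ne_top hT) hle
    (R := rad T) (fun t ht => le_iSup₂ (f := fun t (_ : t ∈ T) => ‖t‖ₑ) t ht) k₀
  refine ⟨Φ, hΦm, hΦi, fun ω => iSup₂_le fun x hx => ?_⟩
  rw [← Real.enorm_eq_ofReal_abs, euclMulVec_eq_linComb]
  exact hΦ ω x hx

theorem two_rpow_div_le {α : ℝ} (hα : 0 < α) {k : ℕ} {u : ℝ≥0}
    (h : (2 : ℝ) ^ k ≤ 2 * (u : ℝ) ^ α) :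
    (2 : ℝ≥0∞) ^ ((k : ℝ) / α) ≤ (2 : ℝ≥0∞) ^ (1 / α) * u := by
  have h1 : (2 : ℝ≥0∞) ^ (k : ℝ) ≤ 2 * (u : ℝ≥0∞) ^ α := by
    rw [ENNReal.rpow_natCast, ← ENNReal.coe_rpow_of_nonneg _ hα.le]
    have : (2 : ℝ≥0) ^ k ≤ 2 * u ^ α := by
      rw [← NNReal.coe_le_coe]; push_cast; exact h
    exact_mod_cast this
  calc (2 : ℝ≥0∞) ^ ((k : ℝ) / α) = ((2 : ℝ≥0∞) ^ (k : ℝ)) ^ (1 / α) := by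
        rw [← ENNReal.rpow_mul]; congr 1; ring
    _ ≤ (2 * (u : ℝ≥0∞) ^ α) ^ (1 / α) := ENNReal.rpow_le_rpow h1 (by positivity)
    _ = _ := by
        rw [ENNReal.mul_rpow_of_nonneg _ _ (by positivity), ← ENNReal.rpow_mul,
          mul_one_div_cancel hα.ne', ENNReal.rpow_one]

/-- The `α`-dependent constant of the main theorem. -/
noncomputable def distortionConst (α : ℝ) : ℝ≥0 :=
  Real.toNNReal (Real.exp 2) * incrementConst α * 6 * 2 ^ (1 / α)

theorem coe_distortionConst {α : ℝ} (hα : 0 < α) :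
    (distortionConst α : ℝ≥0∞)
      = ENNReal.ofReal (Real.exp 2) * incrementConst α * 6 * 2 ^ (1 / α) := by
  unfold distortionConst
  rw [ENNReal.coe_mul, ENNReal.coe_mul, ENNReal.coe_mul,
    ENNReal.coe_rpow_of_nonneg _ (by positivity)]
  rfl

theorem distortionConst_ne_zero {α : ℝ} (hα : 0 < α) : distortionConst α ≠ 0 := by
  have h1 : 0 < Real.toNNReal (Real.exp 2) := Real.toNNReal_pos.2 (Real.exp_pos 2)
  have h2 := (incrementConst_ne_zero hα).bot_lt
  have h3 : (0 : ℝ≥0) < 2 ^ (1 / α) := NNReal.rpow_pos two_pos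
  have : 0 < distortionConst α := by
    unfold distortionConst
    exact mul_pos (mul_pos (mul_pos h1 h2) (by norm_num)) h3
  exact this.ne'

/-- Here `c` stands for `1 + Φ` or its mean. The `6` is `3` for `c` times `2` for the near-optimal
partitions. -/
theorem chaining_bound_le_distortionConst {α : ℝ} (hα : 0 < α) {K : ℝ≥0} {c s a γ : ℝ≥0∞}
    (hc : c ≤ 3) (hs : s ≤ 2 ^ (1 / α) * a) :
    ENNReal.ofReal (Real.exp 2) * (incrementConst α * K : ℝ≥0) * c * (s + 2 * γ)
      ≤ distortionConst α * K * (γ + a) := by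
  have h1 : (1 : ℝ≥0∞) ≤ 2 ^ (1 / α) := ENNReal.one_le_rpow one_le_two (by positivity)
  rw [coe_distortionConst hα, ENNReal.coe_mul]
  set e := ENNReal.ofReal (Real.exp 2)
  set b : ℝ≥0∞ := ((incrementConst α : ℝ≥0) : ℝ≥0∞)
  set w : ℝ≥0∞ := 2 ^ (1 / α)
  calc e * (b * K) * c * (s + 2 * γ) ≤ e * (b * K) * 3 * (2 * (w * a) + 2 * (w * γ)) := by
        gcongr
        · refine hs.trans ?_
          rw [two_mul]; exact le_self_add
        · exact le_mul_of_one_le_left bot_le h1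
    _ = e * b * (3 * 2) * w * K * (γ + a) := by ring
    _ = _ := by norm_num

theorem lintegral_distortion_le [IsProbabilityMeasure P] {α : ℝ} (hα : 0 < α) {m n : ℕ}
    {A : Ω → Matrix (Fin m) (Fin n) ℝ} {K : ℝ≥0} (hK : K ≠ 0)
    (h : UnitVectorModel P (fun j ω => euclCol (A ω) j)
      (2 * (K : ℝ) ^ 2 * (2 / α) ^ (2 / α)) (2 / α))
    {T : Set (EuclideanSpace ℝ (Fin n))} (hT : talagrandGamma α T ≠ ⊤) :
    ∫⁻ ω, distortion (A ω) T ∂P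
      ≤ distortionConst α * K * (talagrandGamma α T + rad T) := by
  obtain ⟨Φ, hΦm, hΦi, hΦ⟩ := exists_distortion_le hα hK h hT 0
  have hi : ∫⁻ ω, (1 + Φ ω) ∂P ≤ 3 := by
    rw [lintegral_add_left measurable_const, lintegral_const, measure_univ, one_mul]
    have : ENNReal.ofReal (Real.exp (-2 ^ 0)) ≤ 1 := by
      rw [ENNReal.ofReal_le_one, Real.exp_le_one_iff]; norm_num
    calc 1 + ∫⁻ ω, Φ ω ∂P ≤ 1 + 2 * 1 := by gcongr; exact hΦi.trans (by gcongr)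
      _ = 3 := by norm_num
  refine (lintegral_mono hΦ).trans ?_
  have hm : Measurable fun ω => 1 + Φ ω := measurable_const.add hΦm
  rw [lintegral_mul_const _ (hm.const_mul _), lintegral_const_mul _ hm]
  refine chaining_bound_le_distortionConst hα hi ?_
  simp only [Nat.cast_zero, zero_div, ENNReal.rpow_zero]
  gcongr
  exact ENNReal.one_le_rpow one_le_two (by positivity)

theorem le_measure_distortion_le [IsProbabilityMeasure P] {α : ℝ} (hα : 0 < α) {m n : ℕ}
    {A : Ω → Matrix (Fin m) (Fin n) ℝ} {K : ℝ≥0} (hK : K ≠ 0)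
    (h : UnitVectorModel P (fun j ω => euclCol (A ω) j)
      (2 * (K : ℝ) ^ 2 * (2 / α) ^ (2 / α)) (2 / α))
    {T : Set (EuclideanSpace ℝ (Fin n))} (hT : talagrandGamma α T ≠ ⊤) (u : ℝ≥0) :
    ENNReal.ofReal (1 - (3 : ℝ≥0) * Real.exp (-(u : ℝ) ^ α)) ≤
      P {ω | distortion (A ω) T ≤ distortionConst α * K * (talagrandGamma α T + u * rad T)} := by
  -- For `u < 1` the claimed probability is nonpositive, as `3 / e > 1`.
  rcases lt_or_ge u 1 with hu | hu
  · have h1 : (u : ℝ) ^ α ≤ 1 := Real.rpow_le_one u.2 (by exact_mod_cast hu.le) hα.le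
    have h2 : Real.exp (-1) ≤ Real.exp (-(u : ℝ) ^ α) := Real.exp_le_exp.2 (by linarith)
    have h3 : 1 / 3 ≤ Real.exp (-1) := by
      rw [Real.exp_neg, ← one_div]
      exact one_div_le_one_div_of_le (Real.exp_pos 1) (by linarith [Real.exp_one_lt_d9])
    rw [ENNReal.ofReal_of_nonpos]
    · exact bot_le
    · push_cast; linarith
  have hu1 : 1 ≤ (u : ℝ) ^ α := Real.one_le_rpow (by exact_mod_cast hu) hα.le
  obtain ⟨N, hN1, hN2⟩ := exists_nat_pow_near hu1 (one_lt_two (α := ℝ))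
  -- The level `k₀ = N + 1` satisfies `u^α < 2^k₀ ≤ 2 u^α`: the first inequality gives the tail, the
  -- second bounds `2^(k₀/α)` by `2^(1/α) u`.
  obtain ⟨Φ, hΦm, hΦi, hΦ⟩ := exists_distortion_le hα hK h hT (N + 1)
  set G := {ω | distortion (A ω) T ≤ distortionConst α * K * (talagrandGamma α T + u * rad T)}
  have hbad : P {ω | 1 ≤ Φ ω} ≤ ENNReal.ofReal ((3 : ℝ≥0) * Real.exp (-(u : ℝ) ^ α)) := by
    have h1 := meas_ge_le_lintegral_div (μ := P) hΦm.aemeasurable one_ne_zero ENNReal.one_ne_top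
    rw [div_one] at h1
    refine (h1.trans hΦi).trans ?_
    rw [← ENNReal.ofReal_ofNat 2, ← ENNReal.ofReal_mul zero_le_two]
    refine ENNReal.ofReal_le_ofReal (mul_le_mul (by norm_num) ?_ (Real.exp_pos _).le (by norm_num))
    exact Real.exp_le_exp.2 (neg_le_neg hN2.le)
  -- Covering the whole space instead of taking complements avoids measurability of `G`.
  have hsub : (Set.univ : Set Ω) ⊆ G ∪ {ω | 1 ≤ Φ ω} := fun ω _ => by
    rcases le_or_gt 1 (Φ ω) with h1 | h1
    · exact Or.inr h1
    · refine Or.inl ((hΦ ω).trans (chaining_bound_le_distortionConst hα ?_ ?_))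
      · calc 1 + Φ ω ≤ 1 + 1 := by gcongr
          _ ≤ 3 := by norm_num
      · rw [← mul_assoc]
        gcongr
        refine two_rpow_div_le hα ?_
        rw [pow_succ]; linarith
  rw [ENNReal.ofReal_sub _ (by positivity), ENNReal.ofReal_one, tsub_le_iff_right]
  calc (1 : ℝ≥0∞) = P Set.univ := measure_univ.symm
    _ ≤ P G + P {ω | 1 ≤ Φ ω} := (measure_mono hsub).trans (measure_union_le _ _)
    _ ≤ _ := by gcongr

end

theorem mainTheorem2 :
    ∃ C : ℝ≥0, ∀ α : ℝ, 0 < α → α ≤ 2 → ∃ Cα : ℝ≥0,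
      ∀ (m n : ℕ) (Ω : Type*) [MeasurableSpace Ω] (P : Measure Ω) [IsProbabilityMeasure P]
        (A : Ω → Matrix (Fin m) (Fin n) ℝ) (K : ℝ≥0) (T : Set (EuclideanSpace ℝ (Fin n))),
        (∀ i j, Measurable fun ω => A ω i j) →
        iIndepFun (fun (j : Fin n) (ω : Ω) => euclCol (A ω) j) P →
        (∀ j, ∫ ω, euclCol (A ω) j ∂P = 0) →
        (∀ j, ∀ᵐ ω ∂P, ‖euclCol (A ω) j‖ = 1) →
        (∀ j, psiNormVec P α (fun ω => euclCol (A ω) j) ≤ K) →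
        Bornology.IsBounded T →
          (∫⁻ ω, distortion (A ω) T ∂P ≤ Cα * K * (talagrandGamma α T + rad T)) ∧
          ∀ u : ℝ≥0,
            ENNReal.ofReal (1 - C * Real.exp (-(u : ℝ) ^ α)) ≤
              P {ω | distortion (A ω) T ≤ Cα * K * (talagrandGamma α T + u * rad T)} := by
  refine ⟨3, fun α hα hα2 => ⟨distortionConst α, ?_⟩⟩
  intro m n Ω _ P _ A K T hA hind hmean hnorm hpsi _
  have h := unitVectorModel_euclCol hα hα2 hA hind hmean hnorm hpsi
  -- Serves the degenerate cases: `n = 0`, where the distortion vanishes and `K` may be zero, and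
  -- infinite `γ_α`, which includes empty `T`.
  have htriv : (∀ c, ∀ ω, distortion (A ω) T ≤ distortionConst α * K * (talagrandGamma α T + c)) →
      (∫⁻ ω, distortion (A ω) T ∂P ≤ distortionConst α * K * (talagrandGamma α T + rad T)) ∧
      ∀ u : ℝ≥0, ENNReal.ofReal (1 - (3 : ℝ≥0) * Real.exp (-(u : ℝ) ^ α)) ≤
        P {ω | distortion (A ω) T
          ≤ distortionConst α * K * (talagrandGamma α T + u * rad T)} := by
    intro hle
    refine ⟨(lintegral_mono (hle (rad T))).trans (by simp), fun u => ?_⟩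
    have huniv : {ω | distortion (A ω) T ≤ distortionConst α * K
        * (talagrandGamma α T + u * rad T)} = Set.univ := Set.eq_univ_of_forall (hle _)
    rw [huniv, measure_univ, ENNReal.ofReal_le_one]
    have := Real.exp_pos (-(u : ℝ) ^ α)
    push_cast; linarith
  rcases isEmpty_or_nonempty (Fin n) with hn | ⟨⟨j⟩⟩
  · refine htriv fun c ω => iSup₂_le fun x _ => ?_
    have hx : x = 0 := Subsingleton.elim _ _
    have h0 : euclMulVec (A ω) x = 0 := by
      rw [euclMulVec_eq_linComb]; simp [linComb]
    rw [h0, hx]; simp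
  have hK : K ≠ 0 := by
    rintro rfl
    exact h.sigma_ne_zero j (by simp)
  rcases eq_or_ne (talagrandGamma α T) ⊤ with hT | hT
  · refine htriv fun c ω => ?_
    rw [hT, top_add, ENNReal.mul_top]
    · exact le_top
    · exact mul_ne_zero (by exact_mod_cast distortionConst_ne_zero hα) (by exact_mod_cast hK)
  · exact ⟨lintegral_distortion_le hα hK h hT, le_measure_distortion_le hα hK h hT⟩
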